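/- There are absolute constants $C>0$ and $k\in\mathbb N$ and a universal tester $T$ with the following properties. The tester receives $N\in\mathbb N$ and $\varepsilon\in(0,1)$ and has conditional sampling access to an unknown distribution $\mu$ on $\{1,\dots,N\}$: adaptively, and using internal randomness, it may choose a set $A\subseteq\{1,\dots,N\}$ and receive an independent sample of $\mu$ conditioned on $A$ (if $\mu(A)=0$, the answer follows an arbitrary fixed convention, and $T$ works for every such convention). It always uses at most $$C\cdot\frac{\log N\cdot\max\{1,\log\log N\}}{\varepsilon^{7}}\cdot\bigl(1+\log\tfrac1\varepsilon\bigr)^{k}$$ conditional samples (this bound is read as $0$ for $N=1$), that is, $O\bigl(\varepsilon^{-7}\log N\log\log N\cdot\mathrm{poly}(\log \varepsilon^{-1})\bigr)$. The sampling does not depend on any property. At the end, $T$ outputs a verdict (accept or reject) for every set $\mathcal P$ of distributions on $\{1,\dots,N\}$. For every label-invariant $\mathcal P$ (that is, $\mathcal P$ is closed under permuting the labels $1,\dots,N$) the verdict is an $\varepsilon$-test of $\mathcal P$: * if $\mu\in\mathcal P$, then $T$ accepts $\mathcal P$ with probability at least $2/3$; * if $d_{\mathrm{TV}}(\mu,\nu)>\varepsilon$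 for every $\nu\in\mathcal P$, then $T$ rejects $\mathcal P$ with probability at least $2/3$. Here $d_{\mathrm{TV}}(\mu,\nu)=\frac12\sum_x|\mu(x)-\nu(x)|$. -/

import Mathlib

/-- A randomized adaptive algorithm with conditional sampling access to an unknown distribution
over `Ω`, and with outputs in `R`, as a decision tree: it may stop, draw internal randomness from
any discrete distribution, or ask for a sample conditioned on a set `A`. A conditional sample is
`some x`; `none` is an error symbol, which an oracle may return only for a null set. -/
inductive CondAlg (Ω R : Type) : Type
  | ret (r : R) : CondAlg Ω R
  | rand (p : PMF ℕ) (next : ℕ → CondAlg Ω R) : CondAlg Ω R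
  | query (A : Set Ω) (next : Option Ω → CondAlg Ω R) : CondAlg Ω R

/-- `O` is a conditional sampling oracle for `μ`: given a set `A` of positive probability, it
answers with an element distributed like `μ` conditioned on `A`. Its behaviour on null sets is
left open, so that every convention for them (an error symbol, a uniform element of `A`, ...) is a
conditional sampling oracle. -/
def IsCondOracle {Ω : Type} (μ : PMF Ω) (O : Set Ω → PMF (Option Ω)) : Prop :=
  ∀ (A : Set Ω) (h : ∃ a ∈ A, a ∈ μ.support), O A = (μ.filter A h).map some

/-- The law of the output of an algorithm that interacts with the oracle `O`. All oracle answers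
and all internal random choices are drawn independently. -/
noncomputable def CondAlg.run {Ω R : Type} (O : Set Ω → PMF (Option Ω)) : CondAlg Ω R → PMF R
  | .ret r => PMF.pure r
  | .rand p next => p.bind fun i => (next i).run O
  | .query A next => (O A).bind fun x => (next x).run O

/-- On every computation path, at most `q` conditional samples are requested. -/
def CondAlg.UsesAtMost {Ω R : Type} : CondAlg Ω R → ℕ → Prop
  | .ret _, _ => True
  | .rand _ next, q => ∀ i, (next i).UsesAtMost q
  | .query _ _, 0 => False
  | .query _ next, q + 1 => ∀ x, (next x).UsesAtMost q

/-- Total variation distance. -/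
noncomputable def tvDist {Ω : Type} [Fintype Ω] (μ τ : PMF Ω) : ℝ :=
  (1 / 2) * ∑ x, |(μ x).toReal - (τ x).toReal|

/-- A property of distributions is label-invariant if it is closed under permuting the domain. -/
def LabelInvariant {Ω : Type} (P : Set (PMF Ω)) : Prop :=
  ∀ π : Equiv.Perm Ω, ∀ μ ∈ P, μ.map π ∈ P

/-- `T` is run once, without knowledge of any property, and outputs a verdict (`true` = accept)
for every property. It `ε`-tests `P` if its verdict for `P` is correct with probability at least
`2/3`, whatever the input distribution `μ` and the conditional sampling oracle for `μ`. -/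
def EpsTests {Ω : Type} [Fintype Ω] (T : CondAlg Ω (Set (PMF Ω) → Bool)) (ε : ℝ)
    (P : Set (PMF Ω)) : Prop :=
  ∀ (μ : PMF Ω) (O : Set Ω → PMF (Option Ω)), IsCondOracle μ O →
    (μ ∈ P → 2 / 3 ≤ ((T.run O).map fun verdict => verdict P) true) ∧
    ((∀ ν ∈ P, ε < tvDist μ ν) → 2 / 3 ≤ ((T.run O).map fun verdict => verdict P) false)

/-!
The tester learns the histogram of `μ`. It draws `x` from `μ` and estimates `μ x` up to a factor
close to `1`, recorded as the index of a point of a geometric grid with `O(ε⁻¹ log N)` points (up to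
factors that are logarithmic in `ε⁻¹`), and it repeats this until the empirical law of the index is
near to the true law. A property is accepted if the empirical law is near to the law that some
member of the property would produce (`FinAlg.verdict`). This is sound because the law of the index
determines the distribution up to a permutation (`FinAlg.exists_perm_tvDist_le`): two distributions
with nearly equal laws have a coupling in which `x` and `x'` mostly have nearly equal masses, the
coupling divided by `max (μ x) (ν x')` is doubly substochastic, and Birkhoff's theorem turns it into
a permutation (`exists_perm_dist_le`).

The estimator for `μ x` rests on comparisons: a sample conditioned on `{x, y}` is `x` with
probability `μ x / (μ x + μ y)`, so the part `μ x * μ y / (μ x + μ y)` of the mass of `y` that loses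
against `x` is at most `μ x`. The total `W` of these parts is estimated directly from samples of
`μ`; it is rarely small for `x` drawn from `μ`, since it is at least half the mass of the elements
that are no heavier than `x`. Moreover, let `A` be a random set that contains each element except
`x` with probability `2⁻ʲ`. Sampling from `A ∪ {x}` until `x` appears, the expected number of
comparisons won by `x` is exactly `2⁻ʲ (W / μ x - 1)`, and its variance is bounded in terms of this
mean. Heavy elements of `A` affect only the number of samples, so that stopping after `O(ε⁻²)`
samples costs a small bias (`FinAlg.abs_ev_trial_sub_le`). With a density for which `2⁻ʲ W / μ x` is
of constant order, `O(ε⁻²)` games give `W / μ x`, and hence `μ x`.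

This density is found by binary search on `j`. The error probability of a test decays geometrically
in the distance of `j` from the target, so that the errors at all `j` together have small
probability (`FinAlg.pr_search_le`, `FinAlg.sum_testErr_le`), and the `O(log log N)` steps need no
further repetition.
-/

/-! ### Finite programs and their expectation functional -/

/-- A program with conditional sampling access to a distribution over `Ω`, whose only internal
randomness is a random indicator function on `Ω`. For a finite `Ω` every random choice is among
finitely many outcomes, so that expectations are finite sums. -/
inductive FinAlg (Ω R : Type) : Type
  | ret (r : R) : FinAlg Ω R
  | draw (p : PMF (Ω → Bool)) (next : (Ω → Bool) → FinAlg Ω R) : FinAlg Ω R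
  | query (A : Set Ω) (next : Option Ω → FinAlg Ω R) : FinAlg Ω R

namespace FinAlg

variable {Ω R S : Type}

/-- Sequential composition. -/
def bind : FinAlg Ω R → (R → FinAlg Ω S) → FinAlg Ω S
  | .ret r, k => k r
  | .draw p next, k => .draw p fun h => (next h).bind k
  | .query A next, k => .query A fun z => (next z).bind k

/-- On every computation path, at most `q` conditional samples are requested. -/
def UsesAtMost : FinAlg Ω R → ℕ → Prop
  | .ret _, _ => True
  | .draw _ next, q => ∀ h, (next h).UsesAtMost q
  | .query _ _, 0 => False
  | .query _ next, q + 1 => ∀ z, (next z).UsesAtMost q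

lemma UsesAtMost.mono {a : FinAlg Ω R} {q q' : ℕ} (h : a.UsesAtMost q) (hq : q ≤ q') :
    a.UsesAtMost q' := by
  induction a generalizing q q' with
  | ret r => trivial
  | draw p next ih => exact fun x => ih x (h x) hq
  | query A next ih =>
    cases q with
    | zero => exact h.elim
    | succ q =>
      obtain ⟨q'', rfl⟩ : ∃ q'', q' = q'' + 1 := ⟨q' - 1, by omega⟩
      exact fun z => ih z (h z) (by omega)

lemma UsesAtMost.bind {a : FinAlg Ω R} {k : R → FinAlg Ω S} {q q' : ℕ} (h : a.UsesAtMost q)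
    (hk : ∀ r, (k r).UsesAtMost q') : (a.bind k).UsesAtMost (q + q') := by
  induction a generalizing q with
  | ret r => exact (hk r).mono (by omega)
  | draw p next ih => exact fun x => ih x (h x)
  | query A next ih =>
    cases q with
    | zero => exact h.elim
    | succ q =>
      rw [Nat.succ_add]
      exact fun z => ih z (h z)

/-- Run a program `n` times independently and list the outputs. -/
def rep (a : FinAlg Ω R) : ℕ → FinAlg Ω (List R)
  | 0 => .ret []
  | n + 1 => a.bind fun r => (a.rep n).bind fun l => .ret (r :: l)

lemma UsesAtMost.rep {a : FinAlg Ω R} {q : ℕ} (h : a.UsesAtMost q) (n : ℕ) :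
    (a.rep n).UsesAtMost (n * q) := by
  induction n with
  | zero => trivial
  | succ n ih =>
    refine (h.bind (q' := n * q) fun r => ?_).mono (by rw [Nat.succ_mul]; omega)
    exact ih.bind (q' := 0) fun l => trivial

/-- The translation to the general model; indicator functions are encoded by natural numbers. -/
noncomputable def toCondAlg [Finite Ω] : FinAlg Ω R → CondAlg Ω R
  | .ret r => .ret r
  | .draw p next => .rand (p.map (exists_injective_nat (Ω → Bool)).choose) fun i =>
      (next (Function.invFun (exists_injective_nat (Ω → Bool)).choose i)).toCondAlg
  | .query A next => .query A fun z => (next z).toCondAlg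

lemma UsesAtMost.toCondAlg [Finite Ω] {a : FinAlg Ω R} {q : ℕ} (h : a.UsesAtMost q) :
    a.toCondAlg.UsesAtMost q := by
  induction a generalizing q with
  | ret r => simp [FinAlg.toCondAlg, CondAlg.UsesAtMost]
  | draw p next ih => exact fun i => ih _ (h _)
  | query A next ih =>
    cases q with
    | zero => exact h.elim
    | succ q => exact fun z => ih z (h z)

section Expectation

variable [Fintype Ω] [DecidableEq Ω] (O : Set Ω → PMF (Option Ω))

/-- The expectation of `f` applied to the output of a program that interacts with the oracle
`O`. -/
noncomputable def ev : FinAlg Ω R → (R → ℝ) → ℝ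
  | .ret r, f => f r
  | .draw p next, f => ∑ h, (p h).toReal * (next h).ev f
  | .query A next, f => ∑ z, (O A z).toReal * (next z).ev f

open Classical in
/-- The probability that the output of a program satisfies `P`. -/
noncomputable def pr (a : FinAlg Ω R) (P : R → Prop) : ℝ := a.ev O fun r => if P r then 1 else 0

lemma sum_toReal_pmf {ι : Type*} [Fintype ι] (p : PMF ι) : ∑ i, (p i).toReal = 1 := by
  rw [← ENNReal.toReal_sum fun i _ => p.apply_ne_top i, ← tsum_fintype (L := .unconditional ι),
    p.tsum_coe, ENNReal.toReal_one]

variable {O}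

lemma ev_bind (a : FinAlg Ω R) (k : R → FinAlg Ω S) (f : S → ℝ) :
    (a.bind k).ev O f = a.ev O fun r => (k r).ev O f := by
  induction a with
  | ret r => rfl
  | draw p next ih => simp [bind, ev, ih]
  | query A next ih => simp [bind, ev, ih]

lemma ev_add (a : FinAlg Ω R) (f g : R → ℝ) :
    (a.ev O fun r => f r + g r) = a.ev O f + a.ev O g := by
  induction a with
  | ret r => rfl
  | draw p next ih => simp [ev, ih, mul_add, Finset.sum_add_distrib]
  | query A next ih => simp only [ev, ih, mul_add, Finset.sum_add_distrib]

lemma ev_const_mul (a : FinAlg Ω R) (c : ℝ) (f : R → ℝ) :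
    (a.ev O fun r => c * f r) = c * a.ev O f := by
  induction a with
  | ret r => rfl
  | draw p next ih => simp [ev, ih, Finset.mul_sum, mul_left_comm]
  | query A next ih => simp only [ev, ih, Finset.mul_sum, mul_left_comm]

lemma ev_const (a : FinAlg Ω R) (c : ℝ) : (a.ev O fun _ => c) = c := by
  induction a with
  | ret r => rfl
  | draw p next ih => simp [ev, ih, ← Finset.sum_mul, sum_toReal_pmf]
  | query A next ih => simp only [ev, ih, ← Finset.sum_mul, sum_toReal_pmf, one_mul]

lemma ev_mono (a : FinAlg Ω R) {f g : R → ℝ} (h : ∀ r, f r ≤ g r) : a.ev O f ≤ a.ev O g := by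
  induction a with
  | ret r => exact h r
  | draw p next ih =>
    exact Finset.sum_le_sum fun i _ => mul_le_mul_of_nonneg_left (ih i) ENNReal.toReal_nonneg
  | query A next ih =>
    exact Finset.sum_le_sum fun i _ => mul_le_mul_of_nonneg_left (ih i) ENNReal.toReal_nonneg

lemma ev_sub (a : FinAlg Ω R) (f g : R → ℝ) :
    (a.ev O fun r => f r - g r) = a.ev O f - a.ev O g := by
  have := ev_add (O := O) a f (fun r => (-1) * g r)
  rw [ev_const_mul] at this
  simpa [sub_eq_add_neg] using this

lemma ev_sum {ι : Type*} (s : Finset ι) (a : FinAlg Ω R) (f : ι → R → ℝ) :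
    (a.ev O fun r => ∑ i ∈ s, f i r) = ∑ i ∈ s, a.ev O (f i) := by
  classical
  induction s using Finset.induction_on with
  | empty => simp [ev_const]
  | insert i s hi ih => simp [Finset.sum_insert hi, ev_add, ih]

lemma ev_nonneg (a : FinAlg Ω R) {f : R → ℝ} (h : ∀ r, 0 ≤ f r) : 0 ≤ a.ev O f := by
  simpa [ev_const] using ev_mono (O := O) a h

lemma pr_nonneg (a : FinAlg Ω R) (P : R → Prop) : 0 ≤ a.pr O P :=
  ev_nonneg a fun r => by split_ifs <;> norm_num

lemma pr_mono (a : FinAlg Ω R) {P Q : R → Prop} (h : ∀ r, P r → Q r) : a.pr O P ≤ a.pr O Q :=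
  ev_mono a fun r => by
    by_cases hP : P r
    · simp [hP, h r hP]
    · rw [if_neg hP]; split_ifs <;> norm_num

lemma pr_le_one (a : FinAlg Ω R) (P : R → Prop) : a.pr O P ≤ 1 := by
  rw [← ev_const (O := O) a 1]
  exact ev_mono a fun r => by split_ifs <;> norm_num

lemma pr_or_le (a : FinAlg Ω R) (P Q : R → Prop) :
    a.pr O (fun r => P r ∨ Q r) ≤ a.pr O P + a.pr O Q := by
  unfold pr
  rw [← ev_add]
  refine ev_mono a fun r => ?_
  by_cases hP : P r <;> by_cases hQ : Q r <;> simp [hP, hQ]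

lemma pr_not (a : FinAlg Ω R) (P : R → Prop) : a.pr O (fun r => ¬ P r) = 1 - a.pr O P := by
  unfold pr
  rw [eq_sub_iff_add_eq, ← ev_add]
  refine Eq.trans ?_ (ev_const (O := O) a 1)
  congr 1
  ext r
  by_cases hP : P r <;> simp [hP]

lemma pr_bind (a : FinAlg Ω R) (k : R → FinAlg Ω S) (P : S → Prop) :
    (a.bind k).pr O P = a.ev O fun r => (k r).pr O P :=
  ev_bind a k _

lemma pr_ret (r : R) (P : R → Prop) [Decidable (P r)] :
    (ret r : FinAlg Ω R).pr O P = if P r then 1 else 0 := by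
  unfold pr ev; beta_reduce; congr

lemma pr_bind_ret (a : FinAlg Ω R) (f : R → S) (P : S → Prop) :
    (a.bind fun r => ret (f r)).pr O P = a.pr O fun r => P (f r) :=
  pr_bind a _ P

/-- If a first stage fails with probability at most `α`, and a second stage fails with probability
at most `β` after every success of the first, then the composition fails with probability at most
`α + β`. -/
lemma pr_bind_le {a : FinAlg Ω R} {k : R → FinAlg Ω S} {P : S → Prop} (Bad : R → Prop) {α β : ℝ}
    (hα : a.pr O Bad ≤ α) (hβ : 0 ≤ β) (h : ∀ r, ¬ Bad r → (k r).pr O P ≤ β) :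
    (a.bind k).pr O P ≤ α + β := by
  classical
  rw [pr_bind]
  calc (a.ev O fun r => (k r).pr O P)
      ≤ a.ev O fun r => (if Bad r then 1 else 0) + β := ev_mono a fun r => by
        by_cases hr : Bad r
        · simpa [hr] using (pr_le_one (k r) P).trans (by linarith)
        · simpa [hr] using h r hr
    _ = a.pr O Bad + β := by
      rw [ev_add, ev_const]
      simp only [pr]
    _ ≤ α + β := by linarith

lemma pr_le_div (a : FinAlg Ω R) {f : R → ℝ} (hf : ∀ r, 0 ≤ f r) {c : ℝ} (hc : 0 < c)
    {P : R → Prop} (h : ∀ r, P r → c ≤ f r) : a.pr O P ≤ a.ev O f / c := by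
  rw [le_div_iff₀ hc, mul_comm]
  unfold pr
  rw [← ev_const_mul]
  refine ev_mono a fun r => ?_
  by_cases hP : P r
  · simpa [hP] using h r hP
  · simpa [hP] using hf r

/-- The probabilities of outputs of the translated program. -/
lemma map_run_toCondAlg (a : FinAlg Ω R) (g : R → S) (s : S) :
    ((a.toCondAlg.run O).map g) s = ENNReal.ofReal (a.pr O fun r => g r = s) := by
  have key : ∀ {ι : Type} [Fintype ι] (p : PMF ι) (φ : ι → ℝ), (∀ i, 0 ≤ φ i) →
      ∑' i, p i * ENNReal.ofReal (φ i) = ENNReal.ofReal (∑ i, (p i).toReal * φ i) := by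
    intro ι _ p φ hφ
    rw [tsum_fintype, ENNReal.ofReal_sum_of_nonneg
      fun i _ => mul_nonneg ENNReal.toReal_nonneg (hφ i)]
    refine Finset.sum_congr rfl fun i _ => ?_
    rw [ENNReal.ofReal_mul ENNReal.toReal_nonneg, ENNReal.ofReal_toReal (p.apply_ne_top i)]
  induction a with
  | ret r =>
    classical
    simp only [toCondAlg, CondAlg.run, PMF.pure_map, PMF.pure_apply, pr_ret]
    by_cases h : g r = s
    · simp [h]
    · simp [h, Ne.symm h]
  | draw p next ih =>
    have hinv := Function.leftInverse_invFun (exists_injective_nat (Ω → Bool)).choose_spec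
    simp only [toCondAlg, CondAlg.run, PMF.bind_map, PMF.map_bind, PMF.bind_apply,
      Function.comp_apply, hinv _, ih]
    exact key p _ fun i => pr_nonneg _ _
  | query A next ih =>
    simp only [toCondAlg, CondAlg.run, PMF.map_bind, PMF.bind_apply, ih]
    exact key _ _ fun i => pr_nonneg _ _

/-! ### Independent repetitions -/

/-- Chebyshev's inequality in its quadratic form, for the sum of independent copies. -/
lemma ev_rep_sq_le (a : FinAlg Ω R) (g : R → ℝ) {v : ℝ} (hv : (a.ev O fun r => g r ^ 2) ≤ v)
    (n : ℕ) : ((a.rep n).ev O fun l => ((l.map g).sum - n * a.ev O g) ^ 2) ≤ n * v := by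
  set m := a.ev O g with hm
  have hmean : ∀ n : ℕ, ((a.rep n).ev O fun l => (l.map g).sum) = n * m := by
    intro n
    induction n with
    | zero => simp [rep, ev]
    | succ n ih =>
      simp only [rep, ev_bind, ev, List.map_cons, List.sum_cons, ev_add, ev_const, ih]
      push_cast; ring
  have hsq : (a.ev O fun r => (g r - m) ^ 2) ≤ v := by
    have : (a.ev O fun r => (g r - m) ^ 2)
        = (a.ev O fun r => g r ^ 2) - m ^ 2 := by
      have h1 : (fun r => (g r - m) ^ 2) = fun r => (g r ^ 2 - (2 * m) * g r) + m ^ 2 := by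
        ext r; ring
      rw [h1, ev_add, ev_sub, ev_const_mul, ev_const, ← hm]; ring
    rw [this]; nlinarith [sq_nonneg m]
  induction n with
  | zero => simp [rep, ev]
  | succ n ih =>
    have h1 : ((a.rep (n + 1)).ev O fun l => ((l.map g).sum - ((n + 1 : ℕ) : ℝ) * m) ^ 2)
        = (a.ev O fun r => (g r - m) ^ 2)
          + (a.rep n).ev O fun l => ((l.map g).sum - n * m) ^ 2 := by
      simp only [rep, ev_bind, ev, List.map_cons, List.sum_cons]
      have h2 : ∀ r, ((a.rep n).ev O fun l => (g r + (l.map g).sum - ((n + 1 : ℕ) : ℝ) * m) ^ 2)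
          = (g r - m) ^ 2 + (a.rep n).ev O fun l => ((l.map g).sum - n * m) ^ 2 := by
        intro r
        have h3 : (fun l : List R => (g r + (l.map g).sum - ((n + 1 : ℕ) : ℝ) * m) ^ 2)
            = fun l => ((g r - m) ^ 2 + (2 * (g r - m)) * ((l.map g).sum - n * m))
              + ((l.map g).sum - n * m) ^ 2 := by
          ext l; push_cast; ring
        rw [h3, ev_add, ev_add, ev_const, ev_const_mul, ev_sub, ev_const, hmean]; ring
      simp only [h2, ev_add, ev_const]
    rw [h1]; push_cast; linarith

/-- The average of `n` independent copies is far from `m` with small probability, if the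
expectation is not. -/
lemma pr_rep_avg_le (a : FinAlg Ω R) (g : R → ℝ) {v m δ : ℝ} (hδ : 0 < δ)
    (hv : (a.ev O fun r => g r ^ 2) ≤ v) (hm : |a.ev O g - m| ≤ δ) {n : ℕ} (hn : 0 < n) :
    (a.rep n).pr O (fun l => 2 * δ < |(l.map g).sum / n - m|) ≤ v / (n * δ ^ 2) := by
  have hn' : (0 : ℝ) < n := by exact_mod_cast hn
  refine (pr_le_div _ (fun l => sq_nonneg ((l.map g).sum - n * a.ev O g))
    (c := (n * δ) ^ 2) (by positivity) fun l hl => ?_).trans ?_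
  · rw [← sq_abs ((l.map g).sum - n * a.ev O g)]
    refine pow_le_pow_left₀ (by positivity) ?_ 2
    have h1 : (l.map g).sum - n * a.ev O g
        = n * ((l.map g).sum / n - a.ev O g) := by field_simp
    rw [h1, abs_mul, abs_of_pos hn']
    refine mul_le_mul_of_nonneg_left ?_ hn'.le
    have h2 := abs_sub_le ((l.map g).sum / n) (a.ev O g) m
    linarith
  · refine (div_le_div_of_nonneg_right (ev_rep_sq_le a g hv n) (by positivity)).trans (le_of_eq ?_)
    field_simp

open Classical in
/-- Among `n` independent copies, `k` bad ones are unlikely. -/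
lemma pr_rep_countP_le (a : FinAlg Ω R) (Bad : R → Prop) {q : ℝ} (hq : a.pr O Bad ≤ q)
    (n k : ℕ) : (a.rep n).pr O (fun l => k ≤ l.countP (fun r => decide (Bad r)))
      ≤ 2 ^ n * q ^ k := by
  have hq0 : 0 ≤ q := (pr_nonneg a Bad).trans hq
  induction n generalizing k with
  | zero =>
    rw [rep, pr_ret]
    cases k with
    | zero => simp
    | succ k => simp; positivity
  | succ n ih =>
    cases k with
    | zero =>
      refine (pr_le_one _ _).trans ?_
      simpa using one_le_pow₀ (by norm_num : (1 : ℝ) ≤ 2)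
    | succ k =>
      rw [rep, pr_bind]
      have h1 : ∀ r, ((a.rep n).bind fun l => ret (r :: l)).pr O
          (fun l => k + 1 ≤ l.countP (fun r => decide (Bad r)))
          ≤ (2 ^ n * q ^ k) * (if Bad r then 1 else 0) + 2 ^ n * q ^ (k + 1) := by
        intro r
        rw [pr_bind_ret]
        simp only [List.countP_cons]
        by_cases hr : Bad r
        · simp only [hr, decide_true, if_true, add_le_add_iff_right, mul_one]
          refine (ih k).trans ?_
          have : 0 ≤ 2 ^ n * q ^ (k + 1) := by positivity
          linarith
        · simpa [hr] using ih (k + 1)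
      refine (ev_mono a h1).trans ?_
      rw [ev_add, ev_const, ev_const_mul]
      have : (2 ^ n * q ^ k) * (a.ev O fun r => if Bad r then (1 : ℝ) else 0)
          ≤ (2 ^ n * q ^ k) * q := mul_le_mul_of_nonneg_left hq (by positivity)
      calc _ ≤ (2 ^ n * q ^ k) * q + 2 ^ n * q ^ (k + 1) := by linarith
        _ = _ := by ring

lemma pr_length_rep (a : FinAlg Ω R) (n : ℕ) : (a.rep n).pr O (fun l => l.length ≠ n) = 0 := by
  induction n with
  | zero => classical rw [rep, pr_ret]; simp
  | succ n ih =>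
    rw [rep, pr_bind]
    simp only [pr_bind_ret, List.length_cons, ne_eq, add_left_inj]
    simp only [ne_eq] at ih
    rw [ih, ev_const]

end Expectation

end FinAlg

/-! ### Matching two distributions by a permutation -/

/-- A linear functional with nonnegative coefficients is at most as large on a doubly
substochastic matrix as on a suitable permutation. -/
lemma exists_perm_sum_le {n : Type*} [Fintype n] [DecidableEq n] (D c : n → n → ℝ)
    (hD : ∀ x y, 0 ≤ D x y) (hrow : ∀ x, ∑ y, D x y ≤ 1) (hcol : ∀ y, ∑ x, D x y ≤ 1)
    (hc : ∀ x y, 0 ≤ c x y) :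
    ∃ σ : Equiv.Perm n, ∑ x, ∑ y, D x y * c x y ≤ ∑ x, c x (σ x) := by
  set r : n → ℝ := fun x => 1 - ∑ y, D x y with hr
  set k : n → ℝ := fun y => 1 - ∑ x, D x y with hk
  have hr0 : ∀ x, 0 ≤ r x := fun x => sub_nonneg.2 (hrow x)
  have hk0 : ∀ y, 0 ≤ k y := fun y => sub_nonneg.2 (hcol y)
  set T := ∑ x, r x with hT
  have hT' : ∑ y, k y = T := by
    simp only [hT, hr, hk, Finset.sum_sub_distrib]
    rw [Finset.sum_comm]
  have hT0 : 0 ≤ T := Finset.sum_nonneg fun x _ => hr0 x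
  -- The missing row and column masses are filled in by a matrix of rank one.
  set E : n → n → ℝ := fun x y => D x y + r x * k y / T with hE
  have hE0 : ∀ x y, 0 ≤ E x y := fun x y =>
    add_nonneg (hD x y) (div_nonneg (mul_nonneg (hr0 x) (hk0 y)) hT0)
  have hErow : ∀ x, ∑ y, E x y = 1 := by
    intro x
    simp only [hE, Finset.sum_add_distrib, ← Finset.sum_div, ← Finset.mul_sum, hT']
    rcases eq_or_lt_of_le hT0 with h | h
    · have : r x = 0 := (Finset.sum_eq_zero_iff_of_nonneg fun x _ => hr0 x).1 h.symm x
        (Finset.mem_univ x)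
      simp only [hr] at this
      rw [← h]; simp; linarith
    · rw [mul_div_cancel_right₀ _ h.ne']; simp [hr]
  have hEcol : ∀ y, ∑ x, E x y = 1 := by
    intro y
    simp only [hE, Finset.sum_add_distrib, ← Finset.sum_div, ← Finset.sum_mul, ← hT]
    rcases eq_or_lt_of_le hT0 with h | h
    · have : k y = 0 := (Finset.sum_eq_zero_iff_of_nonneg fun x _ => hk0 x).1 (hT'.trans h.symm) y
        (Finset.mem_univ y)
      simp only [hk] at this
      rw [← h]; simp; linarith
    · rw [mul_div_cancel_left₀ _ h.ne']; simp [hk]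
  obtain ⟨w, hw0, hw1, hw⟩ := exists_eq_sum_perm_of_mem_doublyStochastic
    (M := Matrix.of E) (mem_doublyStochastic_iff_sum.2 ⟨hE0, hErow, hEcol⟩)
  have hEw : ∀ x y, E x y = ∑ σ : Equiv.Perm n, w σ * if σ x = y then 1 else 0 := by
    intro x y
    have := congrFun (congrFun hw x) y
    simp only [Matrix.of_apply] at this
    rw [← this, Matrix.sum_apply]
    refine Finset.sum_congr rfl fun σ _ => ?_
    simp [Equiv.Perm.permMatrix, PEquiv.toMatrix_apply]
  have hsum : ∑ x, ∑ y, E x y * c x y = ∑ σ, w σ * ∑ x, c x (σ x) := by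
    simp only [hEw, Finset.sum_mul, Finset.mul_sum]
    calc ∑ x, ∑ y, ∑ σ : Equiv.Perm n, (w σ * if σ x = y then 1 else 0) * c x y
        = ∑ x, ∑ σ : Equiv.Perm n, w σ * c x (σ x) := by
          refine Finset.sum_congr rfl fun x _ => ?_
          rw [Finset.sum_comm]
          refine Finset.sum_congr rfl fun σ _ => ?_
          simp
      _ = _ := Finset.sum_comm
  by_contra! hcon
  have h1 : ∑ x, ∑ y, D x y * c x y ≤ ∑ x, ∑ y, E x y * c x y :=
    Finset.sum_le_sum fun x _ => Finset.sum_le_sum fun y _ =>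
      mul_le_mul_of_nonneg_right
        (le_add_of_nonneg_right (div_nonneg (mul_nonneg (hr0 x) (hk0 y)) hT0)) (hc x y)
  have h2 : ∑ σ, w σ * ∑ x, c x (σ x) < ∑ σ, w σ * ∑ x, ∑ y, D x y * c x y := by
    refine Finset.sum_lt_sum (fun σ _ => mul_le_mul_of_nonneg_left (hcon σ).le (hw0 σ)) ?_
    obtain ⟨σ, hσ⟩ : ∃ σ, 0 < w σ := by
      by_contra! h
      have : ∑ σ, w σ ≤ 0 := Finset.sum_nonpos fun σ _ => h σ
      linarith
    exact ⟨σ, Finset.mem_univ σ, mul_lt_mul_of_pos_left (hcon σ) hσ⟩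
  rw [← Finset.sum_mul, hw1, one_mul] at h2
  linarith

lemma min_eq_half_add_sub_abs_sub (a b : ℝ) : min a b = (a + b - |a - b|) / 2 := by
  rcases le_total a b with h | h
  · rw [min_eq_left h, abs_of_nonpos (sub_nonpos.2 h)]; ring
  · rw [min_eq_right h, abs_of_nonneg (sub_nonneg.2 h)]; ring

/-- If the first coordinates of two random pairs have laws `μ` and `ν`, the second coordinates have
nearly the same law, and a common second coordinate pins down the masses of the first coordinates
up to a factor of `1 - κ` outside of events of probability `δ`, then `μ` and `ν` nearly agree after
a permutation: the two pairs can be coupled along the second coordinate, and the coupling, divided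
by the larger of the two masses, is doubly substochastic. -/
lemma exists_perm_dist_le {Ω ι : Type*} [Fintype Ω] [DecidableEq Ω] [Fintype ι]
    {μ ν : Ω → ℝ} (hμ : ∑ x, μ x = 1) (hν : ∑ x, ν x = 1)
    {J J' : Ω → ι → ℝ} (hJ0 : ∀ x i, 0 ≤ J x i) (hJ0' : ∀ x i, 0 ≤ J' x i)
    (hJ : ∀ x, ∑ i, J x i = μ x) (hJ' : ∀ x, ∑ i, J' x i = ν x)
    (G G' : Ω → ι → Prop) [∀ x i, Decidable (G x i)] [∀ x i, Decidable (G' x i)]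
    {δ κ θ : ℝ} (hbad : ∑ x, ∑ i, (if G x i then 0 else J x i) ≤ δ)
    (hbad' : ∑ x, ∑ i, (if G' x i then 0 else J' x i) ≤ δ)
    (hdist : ∑ i, |∑ x, J x i - ∑ x, J' x i| ≤ 2 * θ) (hκ : 0 ≤ κ) (hκ1 : κ ≤ 1)
    (hclose : ∀ x y i, G x i → G' y i → (1 - κ) * max (μ x) (ν y) ≤ min (μ x) (ν y)) :
    ∃ σ : Equiv.Perm Ω, (1 / 2) * ∑ x, |μ x - ν (σ x)| ≤ κ + θ + 2 * δ := by
  have hμ0 : ∀ x, 0 ≤ μ x := fun x => hJ x ▸ Finset.sum_nonneg fun i _ => hJ0 x i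
  have hν0 : ∀ x, 0 ≤ ν x := fun x => hJ' x ▸ Finset.sum_nonneg fun i _ => hJ0' x i
  set q : ι → ℝ := fun i => ∑ x, J x i with hq
  set q' : ι → ℝ := fun i => ∑ x, J' x i with hq'
  have hq0 : ∀ i, 0 ≤ q i := fun i => Finset.sum_nonneg fun x _ => hJ0 x i
  have hq0' : ∀ i, 0 ≤ q' i := fun i => Finset.sum_nonneg fun x _ => hJ0' x i
  set I : Ω → ι → ℝ := fun x i => if G x i then J x i else 0 with hI
  set I' : Ω → ι → ℝ := fun x i => if G' x i then J' x i else 0 with hI'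
  have hI0 : ∀ x i, 0 ≤ I x i := fun x i => by simp only [hI]; split_ifs; exacts [hJ0 x i, le_rfl]
  have hI0' : ∀ x i, 0 ≤ I' x i := fun x i => by
    simp only [hI']; split_ifs; exacts [hJ0' x i, le_rfl]
  have hIJ : ∀ x i, I x i ≤ J x i := fun x i => by
    simp only [hI]; split_ifs; exacts [le_rfl, hJ0 x i]
  have hIJ' : ∀ x i, I' x i ≤ J' x i := fun x i => by
    simp only [hI']; split_ifs; exacts [le_rfl, hJ0' x i]
  set m : ι → ℝ := fun i => max (q i) (q' i) with hm
  have hm0 : ∀ i, 0 ≤ m i := fun i => (hq0 i).trans (le_max_left _ _)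
  set w : Ω → Ω → ℝ := fun x y => ∑ i, I x i * I' y i / m i with hw
  have hw0 : ∀ x y, 0 ≤ w x y := fun x y => Finset.sum_nonneg fun i _ =>
    div_nonneg (mul_nonneg (hI0 x i) (hI0' y i)) (hm0 i)
  have hwrow : ∀ x, ∑ y, w x y ≤ μ x := by
    intro x
    rw [hw, Finset.sum_comm, ← hJ x]
    refine Finset.sum_le_sum fun i _ => ?_
    rw [← Finset.sum_div, ← Finset.mul_sum]
    refine div_le_of_le_mul₀ (hm0 i) (hJ0 x i) (mul_le_mul (hIJ x i) ?_
      (Finset.sum_nonneg fun y _ => hI0' y i) (hJ0 x i))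
    exact (Finset.sum_le_sum fun y _ => hIJ' y i).trans (le_max_right _ _)
  have hwcol : ∀ y, ∑ x, w x y ≤ ν y := by
    intro y
    rw [hw, Finset.sum_comm, ← hJ' y]
    refine Finset.sum_le_sum fun i _ => ?_
    rw [← Finset.sum_div, ← Finset.sum_mul, mul_comm]
    refine div_le_of_le_mul₀ (hm0 i) (hJ0' y i) (mul_le_mul (hIJ' y i) ?_
      (Finset.sum_nonneg fun x _ => hI0 x i) (hJ0' y i))
    exact (Finset.sum_le_sum fun x _ => hIJ x i).trans (le_max_left _ _)
  have hqsum : ∑ i, q i = 1 := by rw [hq, Finset.sum_comm]; simp [hJ, hμ]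
  have hqsum' : ∑ i, q' i = 1 := by rw [hq', Finset.sum_comm]; simp [hJ', hν]
  have hwtot : 1 - θ - 2 * δ ≤ ∑ x, ∑ y, w x y := by
    set b : ι → ℝ := fun i => ∑ x, (if G x i then 0 else J x i) with hb
    set b' : ι → ℝ := fun i => ∑ x, (if G' x i then 0 else J' x i) with hb'
    have hb0 : ∀ i, 0 ≤ b i := fun i => Finset.sum_nonneg fun x _ => by
      split_ifs; exacts [le_rfl, hJ0 x i]
    have hb0' : ∀ i, 0 ≤ b' i := fun i => Finset.sum_nonneg fun x _ => by
      split_ifs; exacts [le_rfl, hJ0' x i]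
    have hIs : ∀ i, ∑ x, I x i = q i - b i := by
      intro i
      rw [eq_sub_iff_add_eq, hb, hq, ← Finset.sum_add_distrib]
      exact Finset.sum_congr rfl fun x _ => by simp only [hI]; split_ifs <;> simp
    have hIs' : ∀ i, ∑ x, I' x i = q' i - b' i := by
      intro i
      rw [eq_sub_iff_add_eq, hb', hq', ← Finset.sum_add_distrib]
      exact Finset.sum_congr rfl fun x _ => by simp only [hI']; split_ifs <;> simp
    have htot : ∑ x, ∑ y, w x y = ∑ i, (q i - b i) * (q' i - b' i) / m i := by
      calc ∑ x, ∑ y, w x y = ∑ x, ∑ i, I x i * (q' i - b' i) / m i := by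
            refine Finset.sum_congr rfl fun x _ => ?_
            rw [hw, Finset.sum_comm]
            refine Finset.sum_congr rfl fun i _ => ?_
            rw [← Finset.sum_div, ← Finset.mul_sum, hIs']
        _ = _ := by
            rw [Finset.sum_comm]
            refine Finset.sum_congr rfl fun i _ => ?_
            rw [← Finset.sum_div, ← Finset.sum_mul, hIs]
    have hterm : ∀ i, (q i + q' i - |q i - q' i|) / 2 - b i - b' i
        ≤ (q i - b i) * (q' i - b' i) / m i := by
      intro i
      rw [← min_eq_half_add_sub_abs_sub]
      rcases eq_or_lt_of_le (hm0 i) with h | h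
      · rw [← h, div_zero]
        have : min (q i) (q' i) ≤ 0 := (min_le_left _ _).trans ((le_max_left _ _).trans h.symm.le)
        linarith [hb0 i, hb0' i]
      · rw [le_div_iff₀ h]
        have h1 : min (q i) (q' i) * m i = q i * q' i := min_mul_max _ _
        have h2 : q i ≤ m i := le_max_left _ _
        have h3 : q' i ≤ m i := le_max_right _ _
        nlinarith [mul_nonneg (hb0 i) (sub_nonneg.2 h3), mul_nonneg (hb0' i) (sub_nonneg.2 h2),
          mul_nonneg (hb0 i) (hb0' i)]
    rw [htot]
    refine le_trans ?_ (Finset.sum_le_sum fun i _ => hterm i)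
    rw [Finset.sum_sub_distrib, Finset.sum_sub_distrib, ← Finset.sum_div, Finset.sum_sub_distrib,
      Finset.sum_add_distrib, hqsum, hqsum', hb, hb', Finset.sum_comm,
      Finset.sum_comm (f := fun i x => if G' x i then 0 else J' x i)]
    linarith
  obtain ⟨σ, hσ⟩ := exists_perm_sum_le (fun x y => w x y / max (μ x) (ν y))
    (fun x y => min (μ x) (ν y))
    (fun x y => div_nonneg (hw0 x y) ((hμ0 x).trans (le_max_left _ _)))
    (fun x => by
      rcases eq_or_lt_of_le (hμ0 x) with h | h
      · have h0 : ∀ y, w x y = 0 := fun y => (Finset.sum_eq_zero_iff_of_nonneg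
          fun y _ => hw0 x y).1 (le_antisymm ((hwrow x).trans h.symm.le)
            (Finset.sum_nonneg fun y _ => hw0 x y)) y (Finset.mem_univ y)
        simp [h0]
      · calc _ ≤ ∑ y, w x y / μ x := Finset.sum_le_sum fun y _ =>
              div_le_div_of_nonneg_left (hw0 x y) h (le_max_left _ _)
          _ ≤ 1 := by rw [← Finset.sum_div]; exact (div_le_one h).2 (hwrow x))
    (fun y => by
      rcases eq_or_lt_of_le (hν0 y) with h | h
      · have h0 : ∀ x, w x y = 0 := fun x => (Finset.sum_eq_zero_iff_of_nonneg
          fun x _ => hw0 x y).1 (le_antisymm ((hwcol y).trans h.symm.le)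
            (Finset.sum_nonneg fun x _ => hw0 x y)) x (Finset.mem_univ x)
        simp [h0]
      · calc _ ≤ ∑ x, w x y / ν y := Finset.sum_le_sum fun x _ =>
              div_le_div_of_nonneg_left (hw0 x y) h (le_max_right _ _)
          _ ≤ 1 := by rw [← Finset.sum_div]; exact (div_le_one h).2 (hwcol y))
    (fun x y => le_min (hμ0 x) (hν0 y))
  refine ⟨σ, ?_⟩
  have hlow : (1 - κ) * ∑ x, ∑ y, w x y
      ≤ ∑ x, ∑ y, w x y / max (μ x) (ν y) * min (μ x) (ν y) := by
    simp only [Finset.mul_sum]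
    refine Finset.sum_le_sum fun x _ => Finset.sum_le_sum fun y _ => ?_
    by_cases hxy : ∃ i, G x i ∧ G' y i
    · obtain ⟨i, hi, hi'⟩ := hxy
      have h0 := hclose x y i hi hi'
      rcases eq_or_lt_of_le ((hμ0 x).trans (le_max_left (μ x) (ν y))) with h | h
      · have h1 : μ x ≤ 0 := (le_max_left _ _).trans h.symm.le
        have h2 : w x y ≤ 0 := (Finset.single_le_sum (fun y _ => hw0 x y)
          (Finset.mem_univ y)).trans ((hwrow x).trans h1)
        have h3 : w x y = 0 := le_antisymm h2 (hw0 x y)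
        simp [h3]
      · rw [div_mul_eq_mul_div, le_div_iff₀ h]
        nlinarith [mul_le_mul_of_nonneg_left h0 (hw0 x y)]
    · have : w x y = 0 := Finset.sum_eq_zero fun i _ => by
        simp only [hI, hI']
        by_cases h : G x i
        · have h' : ¬ G' y i := fun h' => hxy ⟨i, h, h'⟩
          simp [h']
        · simp [h]
      simp [this]
  have habs : ∑ x, |μ x - ν (σ x)| = 2 - 2 * ∑ x, min (μ x) (ν (σ x)) := by
    have h1 : ∑ x, ν (σ x) = 1 := by rw [Equiv.sum_comp σ ν, hν]
    have h2 : ∀ x, |μ x - ν (σ x)| = μ x + ν (σ x) - 2 * min (μ x) (ν (σ x)) := fun x => by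
      rw [min_eq_half_add_sub_abs_sub]; ring
    simp only [h2, Finset.sum_sub_distrib, Finset.sum_add_distrib, hμ, h1, Finset.mul_sum]
    norm_num
  have hδ : 0 ≤ δ := le_trans (Finset.sum_nonneg fun x _ => Finset.sum_nonneg fun i _ => by
    split_ifs; exacts [le_rfl, hJ0 x i]) hbad
  have hθ : 0 ≤ θ := by
    have := (Finset.sum_nonneg fun i _ => abs_nonneg _).trans hdist
    linarith
  rw [habs]
  nlinarith [mul_le_mul_of_nonneg_left hwtot (sub_nonneg.2 hκ1), mul_nonneg hκ hδ, mul_nonneg hκ hθ]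

/-! ### Conditional samples of pairs and of random sets -/

/-- The probability of an element, as a real number. -/
noncomputable def mass {Ω : Type} (μ : PMF Ω) (y : Ω) : ℝ := (μ y).toReal

lemma mass_nonneg {Ω : Type} (μ : PMF Ω) (y : Ω) : 0 ≤ mass μ y := ENNReal.toReal_nonneg

lemma sum_mass {Ω : Type} [Fintype Ω] (μ : PMF Ω) : ∑ y, mass μ y = 1 :=
  FinAlg.sum_toReal_pmf μ

namespace FinAlg

variable {Ω R : Type} [Fintype Ω] [DecidableEq Ω] {μ : PMF Ω} {O : Set Ω → PMF (Option Ω)}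

lemma ev_query (hO : IsCondOracle μ O) {A : Set Ω} {x : Ω} (hxA : x ∈ A) (hx : 0 < mass μ x)
    (next : Option Ω → FinAlg Ω R) (f : R → ℝ) :
    (query A next).ev O f
      = (∑ y, A.indicator (mass μ) y * (next (some y)).ev O f) / ∑ y, A.indicator (mass μ) y := by
  have hA : ∃ a ∈ A, a ∈ μ.support :=
    ⟨x, hxA, fun h => hx.ne' (by rw [mass, h, ENNReal.toReal_zero])⟩
  have hnone : (O A none).toReal = 0 := by simp [hO A hA]
  have hsome : ∀ y, (O A (some y)).toReal
      = A.indicator (mass μ) y / ∑ y, A.indicator (mass μ) y := by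
    intro y
    have h1 : (O A (some y)) = (μ.filter A hA) y := by
      rw [hO A hA, PMF.map_apply]
      simp [tsum_fintype]
    have h2 : ∀ z, (A.indicator μ z).toReal = A.indicator (mass μ) z := fun z => by
      by_cases hz : z ∈ A <;> simp [hz, mass]
    rw [h1, PMF.filter_apply, ENNReal.toReal_mul, ENNReal.toReal_inv, tsum_fintype,
      ENNReal.toReal_sum, h2, div_eq_mul_inv]
    · simp only [h2]
    · intro z _
      by_cases hz : z ∈ A <;> simp [hz, μ.apply_ne_top]
  simp only [ev, Fintype.sum_option, hnone, hsome, zero_mul, zero_add, Finset.sum_div]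
  exact Finset.sum_congr rfl fun y _ => by ring

lemma ev_query_univ (hO : IsCondOracle μ O) (next : Option Ω → FinAlg Ω R) (f : R → ℝ) :
    (query Set.univ next).ev O f = ∑ y, mass μ y * (next (some y)).ev O f := by
  obtain ⟨x, hx⟩ : ∃ x, 0 < mass μ x := by
    by_contra! h
    have := Finset.sum_nonpos fun x (_ : x ∈ Finset.univ) => h x
    rw [sum_mass] at this
    linarith
  rw [ev_query hO (Set.mem_univ x) hx]
  simp [sum_mass]

/-- Does a sample conditioned on the pair `{x, y}` return `x`? -/
def compare (x y : Ω) : FinAlg Ω Bool :=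
  query {x, y} fun z => ret (decide (z = some x))

lemma ev_compare_self (hO : IsCondOracle μ O) {x : Ω} (hx : 0 < mass μ x) (f : Bool → ℝ) :
    (compare x x).ev O f = f true := by
  rw [compare, ev_query hO (x := x) (by simp) hx]
  simp [Set.indicator_apply, ev, hx.ne']

lemma ev_compare (hO : IsCondOracle μ O) {x y : Ω} (hx : 0 < mass μ x) (hxy : y ≠ x)
    (f : Bool → ℝ) :
    (compare x y).ev O f
      = (mass μ x * f true + mass μ y * f false) / (mass μ x + mass μ y) := by
  have hsum : ∀ F : Ω → ℝ, ∑ z, ({x, y} : Set Ω).indicator (mass μ) z * F z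
      = mass μ x * F x + mass μ y * F y := by
    intro F
    rw [← Finset.sum_subset (Finset.subset_univ ({x, y} : Finset Ω)) fun z _ hz => ?_,
      Finset.sum_pair hxy.symm]
    · simp
    · simp only [Finset.mem_insert, Finset.mem_singleton, not_or] at hz
      simp [hz.1, hz.2]
  have h1 := hsum fun _ => 1
  simp only [mul_one] at h1
  rw [compare, ev_query hO (x := x) (by simp) hx, h1, hsum]
  simp [ev, hxy]

/-- The part of the mass of `y` that passes (that is, loses) the comparison with `x`, in units of
`μ x`; it is `0` for `y = x`. Since it is at most `1`, heavy elements have a bounded influence. -/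
noncomputable def passRatio (μ : PMF Ω) (x y : Ω) : ℝ :=
  if y = x then 0 else mass μ y / (mass μ x + mass μ y)

/-- The mass of `y` in units of `μ x`, or `0` for `y = x`. -/
noncomputable def massRatio (μ : PMF Ω) (x y : Ω) : ℝ :=
  if y = x then 0 else mass μ y / mass μ x

omit [Fintype Ω] in
lemma passRatio_nonneg (μ : PMF Ω) (x y : Ω) : 0 ≤ passRatio μ x y := by
  unfold passRatio
  split_ifs
  · exact le_rfl
  · exact div_nonneg (mass_nonneg _ _) (add_nonneg (mass_nonneg _ _) (mass_nonneg _ _))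

omit [Fintype Ω] in
lemma passRatio_le_one (μ : PMF Ω) (x y : Ω) : passRatio μ x y ≤ 1 := by
  unfold passRatio
  split_ifs
  · exact zero_le_one
  · exact div_le_one_of_le₀ (by linarith [mass_nonneg μ x])
      (add_nonneg (mass_nonneg _ _) (mass_nonneg _ _))

omit [Fintype Ω] in
lemma massRatio_nonneg (μ : PMF Ω) (x y : Ω) : 0 ≤ massRatio μ x y := by
  unfold massRatio
  split_ifs
  · exact le_rfl
  · exact div_nonneg (mass_nonneg _ _) (mass_nonneg _ _)

omit [Fintype Ω] in
lemma passRatio_le_massRatio {x : Ω} (hx : 0 < mass μ x) (y : Ω) :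
    passRatio μ x y ≤ massRatio μ x y := by
  unfold passRatio massRatio
  split_ifs
  · exact le_rfl
  · exact div_le_div_of_nonneg_left (mass_nonneg _ _) hx (by linarith [mass_nonneg μ y])

lemma sum_massRatio_le {x : Ω} (hx : 0 < mass μ x) : ∑ y, massRatio μ x y ≤ 1 / mass μ x := by
  rw [← sum_mass μ, Finset.sum_div]
  refine Finset.sum_le_sum fun y _ => ?_
  unfold massRatio
  split_ifs
  · exact div_nonneg (mass_nonneg _ _) hx.le
  · exact le_rfl

/-- The total of a weight function over the set with the indicator function `h`. -/
def selSum (h : Ω → Bool) (a : Ω → ℝ) : ℝ := ∑ y, (if h y then 1 else 0) * a y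

omit [DecidableEq Ω] in
lemma selSum_nonneg (h : Ω → Bool) {a : Ω → ℝ} (ha : ∀ y, 0 ≤ a y) : 0 ≤ selSum h a :=
  Finset.sum_nonneg fun y _ => mul_nonneg (by split_ifs <;> norm_num) (ha y)

omit [DecidableEq Ω] in
lemma selSum_mono (h : Ω → Bool) {a b : Ω → ℝ} (hab : ∀ y, a y ≤ b y) : selSum h a ≤ selSum h b :=
  Finset.sum_le_sum fun y _ => mul_le_mul_of_nonneg_left (hab y) (by split_ifs <;> norm_num)

/-- Sample from the set `Q` repeatedly until `x` appears, compare every other sample with `x`, and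
count the comparisons that `x` wins. Once `b` samples of `Q` have been used, the game stops with
one extra point, so that the outcome `0` certifies that `x` came first. The answer `none` has
probability zero, and the outcome in this case is arbitrary. -/
def game (x : Ω) (Q : Set Ω) : ℕ → FinAlg Ω ℕ
  | 0 => ret 1
  | b + 1 => query Q fun z => z.elim (ret 0) fun y =>
      if y = x then ret 0
      else (compare x y).bind fun c =>
        if c then (game x Q b).bind fun g => ret (g + 1) else game x Q b

omit [Fintype Ω] in
lemma usesAtMost_compare (x y : Ω) : (compare x y).UsesAtMost 1 := fun _ => trivial

omit [Fintype Ω] in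
lemma usesAtMost_game (x : Ω) (Q : Set Ω) (b : ℕ) : (game x Q b).UsesAtMost (2 * b) := by
  induction b with
  | zero => trivial
  | succ b ih =>
    intro z
    cases z with
    | none => trivial
    | some y =>
      simp only [Option.elim]
      split_ifs
      · trivial
      · refine ((usesAtMost_compare x y).bind (q' := 2 * b) fun c => ?_).mono (by
          change 1 + 2 * b ≤ 2 * b + 1; omega)
        cases c
        · exact ih
        · exact ih.bind (q' := 0) fun g => trivial

/-- One round of the game. -/
lemma ev_game_succ (hO : IsCondOracle μ O) {x : Ω} (hx : 0 < mass μ x) (h : Ω → Bool) (b : ℕ)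
    (f : ℕ → ℝ) :
    (1 + selSum h (massRatio μ x)) * (game x {y | y = x ∨ h y} (b + 1)).ev O f
      = f 0 + selSum h (passRatio μ x) * (game x {y | y = x ∨ h y} b).ev O (fun g => f (g + 1))
        + (selSum h (massRatio μ x) - selSum h (passRatio μ x))
          * (game x {y | y = x ∨ h y} b).ev O f := by
  set Q : Set Ω := {y | y = x ∨ h y} with hQ
  set α := (game x Q b).ev O (fun g => f (g + 1))
  set β := (game x Q b).ev O f
  have hxQ : Q.indicator (mass μ) x = mass μ x := by simp [hQ]
  have hyQ : ∀ y ∈ Finset.univ.erase x, Q.indicator (mass μ) y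
      = mass μ x * ((if h y then 1 else 0) * massRatio μ x y) := by
    intro y hy
    have hyx := Finset.ne_of_mem_erase hy
    by_cases hh : h y <;> simp [hQ, hyx, hh, massRatio]
    field_simp
  have hsel : ∀ a : Ω → ℝ, a x = 0 →
      selSum h a = ∑ y ∈ Finset.univ.erase x, (if h y then 1 else 0) * a y := by
    intro a ha
    rw [selSum, ← Finset.add_sum_erase _ _ (Finset.mem_univ x), ha, mul_zero, zero_add]
  have hm := hsel (massRatio μ x) (by simp [massRatio])
  have hr := hsel (passRatio μ x) (by simp [passRatio])
  have htot : ∑ y, Q.indicator (mass μ) y = mass μ x * (1 + selSum h (massRatio μ x)) := by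
    rw [← Finset.add_sum_erase _ _ (Finset.mem_univ x), hxQ, Finset.sum_congr rfl hyQ,
      ← Finset.mul_sum, hm]
    ring
  have hM : 0 ≤ selSum h (massRatio μ x) := selSum_nonneg h (massRatio_nonneg μ x)
  have hnum : ∑ y, Q.indicator (mass μ) y * ((some y).elim (ret 0 : FinAlg Ω ℕ) fun y =>
      if y = x then ret 0
      else (compare x y).bind fun c =>
        if c then (game x Q b).bind fun g => ret (g + 1) else game x Q b).ev O f
      = mass μ x * (f 0 + selSum h (passRatio μ x) * α
        + (selSum h (massRatio μ x) - selSum h (passRatio μ x)) * β) := by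
    rw [← Finset.add_sum_erase _ _ (Finset.mem_univ x), hxQ, hm, hr, ← Finset.sum_sub_distrib,
      mul_add, mul_add, add_assoc, Finset.sum_mul, Finset.sum_mul, Finset.mul_sum, Finset.mul_sum,
      ← Finset.sum_add_distrib]
    congr 1
    · simp [ev]
    · refine Finset.sum_congr rfl fun y hy => ?_
      have hyx := Finset.ne_of_mem_erase hy
      have hpos : 0 < mass μ x + mass μ y := add_pos_of_pos_of_nonneg hx (mass_nonneg μ y)
      rw [hyQ y hy]
      simp only [Option.elim, hyx, if_false, ev_bind, ev_compare hO hx hyx, if_true, ev,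
        massRatio, passRatio, Bool.false_eq_true]
      change _ * ((mass μ x * α + mass μ y * β) / _) = _
      field_simp
      ring
  rw [game, ev_query hO (x := x) (by simp [hQ]) hx, hnum, htot]
  field_simp

section Game

variable (hO : IsCondOracle μ O) {x : Ω} (hx : 0 < mass μ x) (h : Ω → Bool) (b : ℕ)
include hO hx

lemma ev_game_id : (game x {y | y = x ∨ h y} b).ev O (fun g => (g : ℝ))
    = selSum h (passRatio μ x) + (1 - selSum h (passRatio μ x))
      * (selSum h (massRatio μ x) / (1 + selSum h (massRatio μ x))) ^ b := by
  have hM : 0 ≤ selSum h (massRatio μ x) := selSum_nonneg h (massRatio_nonneg μ x)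
  induction b with
  | zero => simp [game, ev]
  | succ b ih =>
    have := ev_game_succ hO hx h b fun g => (g : ℝ)
    simp only [Nat.cast_add, Nat.cast_one, ev_add, ev_const, ih, Nat.cast_zero] at this
    refine mul_left_cancel₀ (by positivity : 1 + selSum h (massRatio μ x) ≠ 0) (this.trans ?_)
    rw [pow_succ]
    field_simp
    ring

lemma ev_game_id_le_add_one : (game x {y | y = x ∨ h y} b).ev O (fun g => (g : ℝ))
    ≤ selSum h (passRatio μ x) + 1 := by
  have hM : 0 ≤ selSum h (massRatio μ x) := selSum_nonneg h (massRatio_nonneg μ x)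
  have hR : 0 ≤ selSum h (passRatio μ x) := selSum_nonneg h (passRatio_nonneg μ x)
  rw [ev_game_id hO hx]
  have h1 : (selSum h (massRatio μ x) / (1 + selSum h (massRatio μ x))) ^ b ≤ 1 :=
    pow_le_one₀ (by positivity) (div_le_one_of_le₀ (by linarith) (by positivity))
  have h0 : 0 ≤ (selSum h (massRatio μ x) / (1 + selSum h (massRatio μ x))) ^ b := by positivity
  nlinarith [mul_nonneg hR h0]

lemma ev_game_sq_le : (game x {y | y = x ∨ h y} b).ev O (fun g => (g : ℝ) ^ 2)
    ≤ 2 * selSum h (passRatio μ x) ^ 2 + 3 * selSum h (passRatio μ x) + 1 := by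
  have hM : 0 ≤ selSum h (massRatio μ x) := selSum_nonneg h (massRatio_nonneg μ x)
  have hR : 0 ≤ selSum h (passRatio μ x) := selSum_nonneg h (passRatio_nonneg μ x)
  have hRM : selSum h (passRatio μ x) ≤ selSum h (massRatio μ x) :=
    selSum_mono h (passRatio_le_massRatio hx)
  induction b with
  | zero => simp only [game, ev, Nat.cast_one]; nlinarith
  | succ b ih =>
    have h1 := ev_game_succ hO hx h b fun g => (g : ℝ) ^ 2
    have h2 : (fun g : ℕ => ((g + 1 : ℕ) : ℝ) ^ 2)
        = fun g : ℕ => ((g : ℝ) ^ 2 + 2 * (g : ℝ)) + 1 := by ext g; push_cast; ring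
    simp only [h2, ev_add, ev_const, ev_const_mul, Nat.cast_zero] at h1
    have h3 := ev_game_id_le_add_one hO hx h b
    refine le_of_mul_le_mul_left (h1.le.trans ?_)
      (by positivity : 0 < 1 + selSum h (massRatio μ x))
    set R := selSum h (passRatio μ x)
    set M := selSum h (massRatio μ x)
    nlinarith [mul_le_mul_of_nonneg_left h3 hR, mul_le_mul_of_nonneg_left ih hM]

lemma pr_game_zero_le : (game x {y | y = x ∨ h y} b).pr O (fun g => g = 0)
    ≤ 1 / (1 + selSum h (passRatio μ x)) := by
  have hM : 0 ≤ selSum h (massRatio μ x) := selSum_nonneg h (massRatio_nonneg μ x)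
  have hR : 0 ≤ selSum h (passRatio μ x) := selSum_nonneg h (passRatio_nonneg μ x)
  have hRM : selSum h (passRatio μ x) ≤ selSum h (massRatio μ x) :=
    selSum_mono h (passRatio_le_massRatio hx)
  induction b with
  | zero => rw [game, pr_ret]; simp; positivity
  | succ b ih =>
    have h1 := ev_game_succ hO hx h b fun g => if g = 0 then 1 else 0
    simp only [Nat.add_eq_zero_iff, one_ne_zero, and_false, if_false, if_true, ev_const] at h1
    have h2 : ∀ b, ((game x {y | y = x ∨ h y} b).ev O fun g => if g = 0 then (1 : ℝ) else 0)
        = (game x {y | y = x ∨ h y} b).pr O (fun g => g = 0) := by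
      intro b; unfold pr; congr!
    rw [h2, h2] at h1
    refine le_of_mul_le_mul_left (h1.le.trans ?_)
      (by positivity : 0 < 1 + selSum h (massRatio μ x))
    set R := selSum h (passRatio μ x)
    set M := selSum h (massRatio μ x)
    calc 1 + R * 0 + (M - R) * _ ≤ 1 + R * 0 + (M - R) * (1 / (1 + R)) := by
          gcongr
      _ = _ := by field_simp; ring

/-- A bound for the bias of the game that comes from its limited number of samples. -/
lemma abs_ev_game_id_sub_le (hb : 0 < b) :
    |(game x {y | y = x ∨ h y} b).ev O (fun g => (g : ℝ)) - selSum h (passRatio μ x)|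
      ≤ (selSum h (massRatio μ x) + selSum h (passRatio μ x) * selSum h (massRatio μ x)) / b
    ∧ (game x {y | y = x ∨ h y} b).ev O (fun g => (g : ℝ))
      ≤ selSum h (passRatio μ x) + selSum h (massRatio μ x) / b := by
  have hM : 0 ≤ selSum h (massRatio μ x) := selSum_nonneg h (massRatio_nonneg μ x)
  have hR : 0 ≤ selSum h (passRatio μ x) := selSum_nonneg h (passRatio_nonneg μ x)
  rw [ev_game_id hO hx]
  set R := selSum h (passRatio μ x)
  set M := selSum h (massRatio μ x)
  have hb' : (0 : ℝ) < b := by exact_mod_cast hb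
  have h0 : 0 ≤ (M / (1 + M)) ^ b := by positivity
  have h1 : (M / (1 + M)) ^ b ≤ M / b := by
    rcases eq_or_lt_of_le hM with h | h
    · rw [← h]; simp [hb.ne']
    · have h2 := one_add_mul_le_pow (a := 1 / M) (by have := one_div_pos.2 h; linarith) b
      have h3 : M / (1 + M) = (1 + 1 / M)⁻¹ := by field_simp; ring
      rw [h3, inv_pow, inv_le_comm₀ (by positivity) (by positivity), inv_div]
      refine le_trans ?_ h2
      rw [mul_one_div]; linarith
  have h4 : R * (M / (1 + M)) ^ b ≤ R * (M / b) := mul_le_mul_of_nonneg_left h1 hR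
  have h5 : 0 ≤ R * (M / (1 + M)) ^ b := mul_nonneg hR h0
  have h6 : (M + R * M) / b = M / b + R * (M / b) := by ring
  refine ⟨?_, by nlinarith⟩
  rw [h6, abs_le]
  have h7 : 0 ≤ M / b := by positivity
  have h8 : 0 ≤ R * (M / b) := by positivity
  constructor <;> nlinarith

end Game

/-! ### Random sets of prescribed density -/

/-- The indicator function of a random set that contains every element independently with
probability `2⁻ʲ`. -/
noncomputable def randomSet (Ω : Type) [Fintype Ω] [DecidableEq Ω] (j : ℕ) : PMF (Ω → Bool) :=
  PMF.ofFintype (fun h => ∏ y, ENNReal.ofReal (if h y then (1 / 2) ^ j else 1 - (1 / 2) ^ j)) (by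
    have h1 : ((1 : ℝ) / 2) ^ j ≤ 1 := pow_le_one₀ (by norm_num) (by norm_num)
    have h2 := Fintype.prod_sum (fun (_ : Ω) (c : Bool) =>
      ENNReal.ofReal (if c then ((1 : ℝ) / 2) ^ j else 1 - (1 / 2) ^ j))
    rw [← h2]
    simp only [Fintype.sum_bool, if_true, Bool.false_eq_true, if_false]
    rw [← ENNReal.ofReal_add (by positivity) (by linarith)]
    simp)

/-- The expectation of a function of a random set of density `2⁻ʲ`. -/
noncomputable def setEv (j : ℕ) (F : (Ω → Bool) → ℝ) : ℝ :=
  ∑ h, (randomSet Ω j h).toReal * F h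

lemma setEv_add (j : ℕ) (F G : (Ω → Bool) → ℝ) :
    (setEv j fun h => F h + G h) = setEv j F + setEv j G := by
  simp only [setEv, mul_add, Finset.sum_add_distrib]

lemma setEv_const_mul (j : ℕ) (c : ℝ) (F : (Ω → Bool) → ℝ) :
    (setEv j fun h => c * F h) = c * setEv j F := by
  simp only [setEv, Finset.mul_sum, mul_left_comm]

lemma setEv_const (j : ℕ) (c : ℝ) : (setEv j fun _ : Ω → Bool => c) = c := by
  simp only [setEv, ← Finset.sum_mul, sum_toReal_pmf, one_mul]

lemma setEv_sum (j : ℕ) {ι : Type*} (s : Finset ι) (F : ι → (Ω → Bool) → ℝ) :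
    (setEv j fun h => ∑ i ∈ s, F i h) = ∑ i ∈ s, setEv j (F i) := by
  simp only [setEv, Finset.mul_sum]
  exact Finset.sum_comm

lemma setEv_mono (j : ℕ) {F G : (Ω → Bool) → ℝ} (h : ∀ A, F A ≤ G A) : setEv j F ≤ setEv j G :=
  Finset.sum_le_sum fun A _ => mul_le_mul_of_nonneg_left (h A) ENNReal.toReal_nonneg

lemma setEv_prod_mem (j : ℕ) (T : Finset Ω) :
    (setEv j fun h => ∏ y ∈ T, if h y then (1 : ℝ) else 0) = ((1 / 2) ^ j) ^ T.card := by
  have h1 : ((1 : ℝ) / 2) ^ j ≤ 1 := pow_le_one₀ (by norm_num) (by norm_num)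
  have h2 := Fintype.prod_sum (fun (y : Ω) (c : Bool) =>
    (if c then ((1 : ℝ) / 2) ^ j else 1 - (1 / 2) ^ j)
      * if y ∈ T then (if c then (1 : ℝ) else 0) else 1)
  calc _ = ∑ h : Ω → Bool, ∏ y, ((if h y then ((1 : ℝ) / 2) ^ j else 1 - (1 / 2) ^ j)
        * if y ∈ T then (if h y then (1 : ℝ) else 0) else 1) := by
        unfold setEv
        refine Finset.sum_congr rfl fun h _ => ?_
        rw [Finset.prod_mul_distrib, Finset.prod_ite_mem, Finset.univ_inter]
        congr 1
        rw [randomSet, PMF.ofFintype_apply, ENNReal.toReal_prod]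
        refine Finset.prod_congr rfl fun y _ => ENNReal.toReal_ofReal ?_
        split_ifs
        · positivity
        · linarith
    _ = ∏ y, if y ∈ T then ((1 : ℝ) / 2) ^ j else 1 := by
        rw [← h2]
        refine Finset.prod_congr rfl fun y _ => ?_
        by_cases hy : y ∈ T <;> simp [hy]
    _ = _ := by rw [Finset.prod_ite_mem, Finset.univ_inter, Finset.prod_const]

lemma setEv_selSum (j : ℕ) (a : Ω → ℝ) :
    (setEv j fun h => selSum h a) = (1 / 2) ^ j * ∑ y, a y := by
  unfold selSum
  rw [setEv_sum, Finset.mul_sum]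
  refine Finset.sum_congr rfl fun y _ => ?_
  have h1 := setEv_prod_mem j {y}
  simp only [Finset.prod_singleton, Finset.card_singleton, pow_one] at h1
  rw [← h1, mul_comm, ← setEv_const_mul]
  simp only [mul_comm]

lemma setEv_selSum_mul_le (j : ℕ) {a c : Ω → ℝ} (ha : ∀ y, 0 ≤ a y) (hc : ∀ y, 0 ≤ c y) :
    (setEv j fun h => selSum h a * selSum h c)
      ≤ ((1 / 2) ^ j * ∑ y, a y) * ((1 / 2) ^ j * ∑ y, c y) + (1 / 2) ^ j * ∑ y, a y * c y := by
  set p : ℝ := (1 / 2) ^ j with hp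
  have hp0 : 0 ≤ p := by positivity
  have h1 : ∀ y z : Ω, (setEv j fun h => (if h y then (1 : ℝ) else 0) * if h z then 1 else 0)
      ≤ p ^ 2 + if y = z then p else 0 := by
    intro y z
    by_cases hyz : y = z
    · subst hyz
      have h2 := setEv_prod_mem j {y}
      simp only [Finset.prod_singleton, Finset.card_singleton, pow_one] at h2
      have h3 : ∀ h : Ω → Bool, ((if h y then (1 : ℝ) else 0) * if h y then 1 else 0)
          = if h y then 1 else 0 := fun h => by split_ifs <;> simp
      simp only [h3, h2, if_true]
      nlinarith
    · have h2 := setEv_prod_mem j {y, z}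
      simp only [Finset.prod_pair hyz, Finset.card_pair hyz] at h2
      rw [h2, if_neg hyz, add_zero]
  have h4 : (setEv j fun h => selSum h a * selSum h c)
      = ∑ y, ∑ z, (a y * c z)
        * setEv j fun h => (if h y then (1 : ℝ) else 0) * if h z then 1 else 0 := by
    simp only [← setEv_const_mul, ← setEv_sum]
    congr 1
    ext h
    rw [selSum, selSum, Finset.sum_mul_sum]
    exact Finset.sum_congr rfl fun y _ => Finset.sum_congr rfl fun z _ => by ring
  rw [h4]
  calc _ ≤ ∑ y, ∑ z, (a y * c z) * (p ^ 2 + if y = z then p else 0) :=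
        Finset.sum_le_sum fun y _ => Finset.sum_le_sum fun z _ =>
          mul_le_mul_of_nonneg_left (h1 y z) (mul_nonneg (ha y) (hc z))
    _ = _ := by
        have h5 : (p * ∑ y, a y) * (p * ∑ y, c y) = ∑ y, ∑ z, (a y * c z) * p ^ 2 := by
          rw [Finset.mul_sum, Finset.mul_sum, Finset.sum_mul_sum]
          exact Finset.sum_congr rfl fun y _ => Finset.sum_congr rfl fun z _ => by ring
        rw [h5, Finset.mul_sum]
        simp only [mul_add, Finset.sum_add_distrib, mul_ite, mul_zero, Finset.sum_ite_eq,
          Finset.mem_univ, if_true]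
        congr 1
        exact Finset.sum_congr rfl fun y _ => by ring

/-! ### The game on a random set -/

/-- The game on the union of `{x}` with a random set of density `2⁻ʲ`. -/
noncomputable def trial (x : Ω) (j b : ℕ) : FinAlg Ω ℕ :=
  draw (randomSet Ω j) fun h => game x {y | y = x ∨ h y} b

lemma usesAtMost_trial (x : Ω) (j b : ℕ) : (trial x j b).UsesAtMost (2 * b) :=
  fun _ => usesAtMost_game _ _ _

/-- The probability that a sample of `μ` passes the comparison with `x`, in units of `μ x`. -/
noncomputable def passTotal (μ : PMF Ω) (x : Ω) : ℝ := 1 + ∑ y, passRatio μ x y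

lemma one_le_passTotal (μ : PMF Ω) (x : Ω) : 1 ≤ passTotal μ x :=
  le_add_of_nonneg_right (Finset.sum_nonneg fun y _ => passRatio_nonneg μ x y)

/-- The quantity that controls the game at density `2⁻ʲ`: `x` usually comes first when it is small,
and some other element usually passes first when it is large. -/
noncomputable def level (μ : PMF Ω) (x : Ω) (j : ℕ) : ℝ := (1 / 2) ^ j * passTotal μ x

lemma level_pos (μ : PMF Ω) (x : Ω) (j : ℕ) : 0 < level μ x j :=
  mul_pos (by positivity) (zero_lt_one.trans_le (one_le_passTotal μ x))

lemma level_succ (μ : PMF Ω) (x : Ω) (j : ℕ) : level μ x j = 2 * level μ x (j + 1) := by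
  unfold level; rw [pow_succ]; ring

section Trial

variable (hO : IsCondOracle μ O) {x : Ω} (hx : 0 < mass μ x) (j : ℕ) {b : ℕ} (hb : 0 < b)

omit [DecidableEq Ω] in
lemma density_le_one : ((1 : ℝ) / 2) ^ j ≤ 1 := pow_le_one₀ (by norm_num) (by norm_num)

lemma density_mul_sum_passRatio :
    (1 / 2) ^ j * ∑ y, passRatio μ x y = level μ x j - (1 / 2) ^ j := by
  unfold level passTotal; ring

lemma density_mul_sum_passRatio_nonneg : 0 ≤ level μ x j - (1 / 2) ^ j := by
  rw [← density_mul_sum_passRatio]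
  exact mul_nonneg (by positivity) (Finset.sum_nonneg fun y _ => passRatio_nonneg μ x y)

include hx in
lemma setEv_massRatio_le : (setEv j fun h => selSum h (massRatio μ x))
    ≤ level μ x j / (mass μ x * passTotal μ x) := by
  have hU := zero_lt_one.trans_le (one_le_passTotal μ x)
  rw [setEv_selSum]
  calc _ ≤ (1 / 2) ^ j * (1 / mass μ x) :=
        mul_le_mul_of_nonneg_left (sum_massRatio_le hx) (by positivity)
    _ = _ := by unfold level; field_simp

lemma setEv_sq_passRatio_le : (setEv j fun h => selSum h (passRatio μ x) ^ 2)
    ≤ (level μ x j - (1 / 2) ^ j) ^ 2 + (level μ x j - (1 / 2) ^ j) := by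
  have h1 := setEv_selSum_mul_le j (passRatio_nonneg μ x) (passRatio_nonneg μ x)
  have h2 : ∑ y, passRatio μ x y * passRatio μ x y ≤ ∑ y, passRatio μ x y :=
    Finset.sum_le_sum fun y _ =>
      mul_le_of_le_one_left (passRatio_nonneg μ x y) (passRatio_le_one μ x y)
  have h3 := mul_le_mul_of_nonneg_left h2 (by positivity : 0 ≤ ((1 : ℝ) / 2) ^ j)
  rw [density_mul_sum_passRatio] at h1 h3
  simp only [sq]
  linarith

include hO hx hb

lemma abs_ev_trial_sub_le :
    |(trial x j b).ev O (fun g => (g : ℝ)) - (level μ x j - (1 / 2) ^ j)|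
      ≤ (2 + level μ x j) * level μ x j / (mass μ x * passTotal μ x) / b := by
  have hb' : (0 : ℝ) < b := by exact_mod_cast hb
  have hp := density_le_one j
  have hU := zero_lt_one.trans_le (one_le_passTotal μ x)
  have hK := density_mul_sum_passRatio_nonneg (μ := μ) (x := x) j
  have hlev := level_pos μ x j
  have h1 : (trial x j b).ev O (fun g => (g : ℝ)) - (level μ x j - (1 / 2) ^ j)
      = setEv j fun h => (game x {y | y = x ∨ h y} b).ev O (fun g => (g : ℝ))
          - selSum h (passRatio μ x) := by
    rw [← density_mul_sum_passRatio, ← setEv_selSum]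
    simp only [trial, ev, setEv, mul_sub, Finset.sum_sub_distrib]
  have h2 : |(setEv j fun h => (game x {y | y = x ∨ h y} b).ev O (fun g => (g : ℝ))
          - selSum h (passRatio μ x))| ≤ setEv j fun h => (selSum h (massRatio μ x)
            + selSum h (passRatio μ x) * selSum h (massRatio μ x)) / b := by
    refine (Finset.abs_sum_le_sum_abs _ _).trans (Finset.sum_le_sum fun h _ => ?_)
    rw [abs_mul, abs_of_nonneg ENNReal.toReal_nonneg]
    exact mul_le_mul_of_nonneg_left (abs_ev_game_id_sub_le hO hx h b hb).1 ENNReal.toReal_nonneg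
  rw [h1]
  refine h2.trans ?_
  simp only [div_eq_inv_mul _ (b : ℝ)]
  rw [setEv_const_mul, setEv_add]
  refine mul_le_mul_of_nonneg_left ?_ (by positivity)
  have h3 := setEv_massRatio_le (μ := μ) hx j
  have h4 := setEv_selSum_mul_le j (passRatio_nonneg μ x) (massRatio_nonneg μ x)
  have h5 : ∑ y, passRatio μ x y * massRatio μ x y ≤ ∑ y, massRatio μ x y :=
    Finset.sum_le_sum fun y _ =>
      mul_le_of_le_one_left (massRatio_nonneg μ x y) (passRatio_le_one μ x y)
  have h6 := mul_le_mul_of_nonneg_left h5 (by positivity : 0 ≤ ((1 : ℝ) / 2) ^ j)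
  rw [density_mul_sum_passRatio] at h4
  rw [setEv_selSum] at h3 ⊢
  have h7 := mul_le_mul_of_nonneg_left h3 hK
  have h8 : 0 ≤ level μ x j / (mass μ x * passTotal μ x) := by positivity
  have h9 : (level μ x j - (1 / 2) ^ j) * (level μ x j / (mass μ x * passTotal μ x))
      ≤ level μ x j * (level μ x j / (mass μ x * passTotal μ x)) :=
    mul_le_mul_of_nonneg_right (by linarith [pow_pos (by norm_num : (0 : ℝ) < 1 / 2) j]) h8
  have h10 : (2 + level μ x j) * level μ x j / (mass μ x * passTotal μ x)
      = 2 * (level μ x j / (mass μ x * passTotal μ x))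
        + level μ x j * (level μ x j / (mass μ x * passTotal μ x)) := by ring
  rw [h10]
  linarith

omit hb in
lemma ev_trial_sq_le : (trial x j b).ev O (fun g => (g : ℝ) ^ 2)
    ≤ 2 * level μ x j ^ 2 + 5 * level μ x j + 1 := by
  have h1 : (trial x j b).ev O (fun g => (g : ℝ) ^ 2) ≤ setEv j fun h =>
      (2 * selSum h (passRatio μ x) ^ 2 + 3 * selSum h (passRatio μ x)) + 1 :=
    setEv_mono j fun h => ev_game_sq_le hO hx h b
  rw [setEv_add, setEv_add, setEv_const, setEv_const_mul, setEv_const_mul, setEv_selSum,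
    density_mul_sum_passRatio] at h1
  have h2 := setEv_sq_passRatio_le (μ := μ) (x := x) j
  have hK := density_mul_sum_passRatio_nonneg (μ := μ) (x := x) j
  have hp : (0 : ℝ) < (1 / 2) ^ j := by positivity
  nlinarith [level_pos μ x j]

omit hb in
lemma pr_trial_zero_le : (trial x j b).pr O (fun g => g = 0) ≤ 2 / level μ x j := by
  have hK := density_mul_sum_passRatio_nonneg (μ := μ) (x := x) j
  set K := level μ x j - (1 / 2) ^ j with hKdef
  have hK1 : 0 < 1 + K := by linarith
  -- The second-order expansion of `1 / (1 + R)` at the mean `K` of `R`.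
  have h1 : (trial x j b).pr O (fun g => g = 0) ≤ setEv j fun h =>
      (((1 + 2 * K) / (1 + K) ^ 2 + K ^ 2 / (1 + K) ^ 2)
        + (-(1 + 2 * K) / (1 + K) ^ 2) * selSum h (passRatio μ x))
        + (1 / (1 + K) ^ 2) * selSum h (passRatio μ x) ^ 2 := by
    refine setEv_mono j fun h => (pr_game_zero_le hO hx h b).trans ?_
    have hR : 0 ≤ selSum h (passRatio μ x) := selSum_nonneg h (passRatio_nonneg μ x)
    set T := selSum h (passRatio μ x)
    have h2 : ((1 + 2 * K) / (1 + K) ^ 2 + K ^ 2 / (1 + K) ^ 2)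
        + (-(1 + 2 * K) / (1 + K) ^ 2) * T + (1 / (1 + K) ^ 2) * T ^ 2 - 1 / (1 + T)
        = T * (T - K) ^ 2 / ((1 + K) ^ 2 * (1 + T)) := by field_simp; ring
    have h3 : 0 ≤ T * (T - K) ^ 2 / ((1 + K) ^ 2 * (1 + T)) := by positivity
    linarith
  refine h1.trans ?_
  rw [setEv_add, setEv_add, setEv_const, setEv_const_mul, setEv_const_mul, setEv_selSum,
    density_mul_sum_passRatio, ← hKdef]
  have h4 := mul_le_mul_of_nonneg_left (setEv_sq_passRatio_le (μ := μ) (x := x) j)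
    (by positivity : 0 ≤ 1 / (1 + K) ^ 2)
  rw [← hKdef] at h4
  have h5 : 2 / (1 + K) ≤ 2 / level μ x j :=
    div_le_div_of_nonneg_left (by norm_num) (level_pos μ x j) (by linarith [density_le_one j])
  refine le_trans ?_ h5
  have h6 : (1 + 2 * K) / (1 + K) ^ 2 + K ^ 2 / (1 + K) ^ 2 + -(1 + 2 * K) / (1 + K) ^ 2 * K
      + 1 / (1 + K) ^ 2 * (K ^ 2 + K) = 2 / (1 + K) - 1 / (1 + K) ^ 2 := by field_simp; ring
  have h7 : 0 ≤ 1 / (1 + K) ^ 2 := by positivity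
  linarith

lemma pr_trial_pos_le (hWb : 1 ≤ mass μ x * passTotal μ x * b) :
    (trial x j b).pr O (fun g => 1 ≤ g) ≤ 2 * level μ x j := by
  have hb' : (0 : ℝ) < b := by exact_mod_cast hb
  have hU := zero_lt_one.trans_le (one_le_passTotal μ x)
  have h1 : (trial x j b).pr O (fun g => 1 ≤ g) ≤ (trial x j b).ev O (fun g => (g : ℝ)) / 1 :=
    pr_le_div _ (fun g => g.cast_nonneg) one_pos fun g hg => by exact_mod_cast hg
  have h2 : (trial x j b).ev O (fun g => (g : ℝ))
      ≤ setEv j fun h => selSum h (passRatio μ x) + (b : ℝ)⁻¹ * selSum h (massRatio μ x) :=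
    setEv_mono j fun h => by
      rw [← div_eq_inv_mul]; exact (abs_ev_game_id_sub_le hO hx h b hb).2
  rw [setEv_add, setEv_const_mul, setEv_selSum, density_mul_sum_passRatio] at h2
  have h3 := mul_le_mul_of_nonneg_left (setEv_massRatio_le (μ := μ) hx j)
    (by positivity : 0 ≤ (b : ℝ)⁻¹)
  have h4 : (b : ℝ)⁻¹ * (level μ x j / (mass μ x * passTotal μ x)) ≤ level μ x j := by
    rw [← div_eq_inv_mul, div_div]
    exact div_le_self (level_pos μ x j).le hWb
  have hp : (0 : ℝ) < (1 / 2) ^ j := by positivity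
  linarith

end Trial

/-! ### Binary search for the density -/

/-- A majority vote on whether the level at density `2⁻ʲ` is large. -/
noncomputable def test (x : Ω) (b u j : ℕ) : FinAlg Ω Bool :=
  ((trial x j b).rep (2 * u)).bind fun l => ret (decide (u ≤ l.countP fun g => decide (1 ≤ g)))

/-- Binary search for the density in the interval of length `2 ^ s` that starts at `lo`. -/
noncomputable def search (x : Ω) (b u : ℕ) : ℕ → ℕ → FinAlg Ω ℕ
  | 0, lo => ret lo
  | s + 1, lo => (test x b u (lo + 2 ^ s)).bind fun c =>
      if c then search x b u s (lo + 2 ^ s) else search x b u s lo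

lemma usesAtMost_test (x : Ω) (b u j : ℕ) : (test x b u j).UsesAtMost (2 * u * (2 * b)) :=
  ((usesAtMost_trial x j b).rep (2 * u)).bind (q' := 0) fun _ => trivial

lemma usesAtMost_search (x : Ω) (b u s lo : ℕ) :
    (search x b u s lo).UsesAtMost (s * (2 * u * (2 * b))) := by
  induction s generalizing lo with
  | zero => trivial
  | succ s ih =>
    refine ((usesAtMost_test x b u _).bind (q' := s * (2 * u * (2 * b))) fun c => ?_).mono
      (le_of_eq (by ring))
    split_ifs
    exacts [ih _, ih _]

lemma countP_lt_of_le_countP_not {α : Type*} {l : List α} {u : ℕ} (p q : α → Bool)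
    (hpq : ∀ a, p a = false → q a = true) (hl : l.length = 2 * u) (h : l.countP q < u) :
    u < l.countP p := by
  have h1 := List.length_eq_countP_add_countP p (l := l)
  have h2 : l.countP (fun a => decide ¬(p a = true)) ≤ l.countP q :=
    List.countP_mono_left fun a _ ha => hpq a (by simpa using ha)
  omega

/-- A bound for the error probability of the test at level `t`, up to a factor of `4⁻ᵘ`. It decays
geometrically in the distance to the levels of order `1`. -/
noncomputable def testErr (t : ℝ) : ℝ :=
  (if 32 * t ≤ 1 then 32 * t else 0) + if 32 / t ≤ 1 then 32 / t else 0

lemma testErr_nonneg {t : ℝ} (ht : 0 < t) : 0 ≤ testErr t := by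
  unfold testErr
  refine add_nonneg ?_ ?_ <;> split_ifs <;> positivity

lemma pow_mul_pow_le {q : ℝ} (hq0 : 0 ≤ q) (hq : 16 * q ≤ 1) {u : ℕ} (hu : 0 < u) :
    2 ^ (2 * u) * q ^ u ≤ (1 / 4) ^ u * (16 * q) := by
  have h1 : (2 : ℝ) ^ (2 * u) * q ^ u = (1 / 4) ^ u * (16 * q) ^ u := by
    rw [pow_mul, ← mul_pow, ← mul_pow]; congr 1; ring
  rw [h1]
  exact mul_le_mul_of_nonneg_left (pow_le_of_le_one (by positivity) hq hu.ne') (by positivity)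

section Search

variable (hO : IsCondOracle μ O) {x : Ω} (hx : 0 < mass μ x) {b u : ℕ} (hb : 0 < b) (hu : 0 < u)
  (hWb : 1 ≤ mass μ x * passTotal μ x * b)
include hO hx hb hu hWb

lemma pr_test_le (j : ℕ) : (test x b u j).pr O (fun c =>
      (c = true ∧ 32 * level μ x j ≤ 1) ∨ (c = false ∧ 32 / level μ x j ≤ 1))
    ≤ (1 / 4) ^ u * testErr (level μ x j) := by
  have hlev := level_pos μ x j
  have h4 : (0 : ℝ) < (1 / 4) ^ u := by positivity
  rw [test, pr_bind_ret, testErr, mul_add]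
  refine (pr_or_le _ _ _).trans (add_le_add ?_ ?_)
  · split_ifs with h
    · refine ((pr_mono _ fun l hl => ?_).trans
        (pr_rep_countP_le (trial x j b) (fun g => 1 ≤ g)
          (pr_trial_pos_le hO hx j hb hWb) (2 * u) u)).trans ?_
      · convert of_decide_eq_true hl.1
      · refine (pow_mul_pow_le (by positivity) (by linarith) hu).trans (le_of_eq ?_)
        ring
    · simp [h, pr, ev_const]
  · split_ifs with h
    · have hlen := pr_length_rep (O := O) (trial x j b) (2 * u)
      refine ((pr_mono _ fun l hl => ?_).trans (pr_or_le _ (fun l => l.length ≠ 2 * u) _)).trans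
        (add_le_add hlen.le (pr_rep_countP_le (trial x j b) (fun g => g = 0)
          (pr_trial_zero_le hO hx j) (2 * u) u)) |>.trans ?_
      · by_cases hl' : l.length = 2 * u
        · right
          by_contra! hcon
          have h1 := countP_lt_of_le_countP_not (fun g => decide (1 ≤ g)) (fun g => decide (g = 0))
            (fun a ha => by simp at ha ⊢; omega) hl' (lt_of_eq_of_lt (by congr!) hcon)
          have h2 := of_decide_eq_false hl.1
          omega
        · exact Or.inl hl'
      · rw [zero_add]
        have h1 : 16 * (2 / level μ x j) = 32 / level μ x j := by ring
        refine (pow_mul_pow_le (by positivity) (by rw [h1]; exact h) hu).trans (le_of_eq ?_)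
        rw [h1]
    · simp [h, pr, ev_const]

/-- The binary search fails with at most the total error probability of the tests at all interior
points: it visits each of them at most once. -/
lemma pr_search_le (s lo : ℕ) (hlo : 1 < 32 * level μ x lo)
    (hhi : level μ x (lo + 2 ^ s) < 32) :
    (search x b u s lo).pr O (fun j => ¬ (1 < 32 * level μ x j ∧ level μ x j < 64))
      ≤ ∑ j ∈ Finset.Ioo lo (lo + 2 ^ s), (1 / 4) ^ u * testErr (level μ x j) := by
  have he : ∀ j, 0 ≤ (1 / 4) ^ u * testErr (level μ x j) := fun j =>
    mul_nonneg (by positivity) (testErr_nonneg (level_pos μ x j))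
  induction s generalizing lo with
  | zero =>
    have h1 := level_succ μ x lo
    have h2 : level μ x lo < 64 := by rw [pow_zero] at hhi; linarith
    classical
    rw [search, pr_ret, if_neg (not_not.2 ⟨hlo, h2⟩)]
    exact Finset.sum_nonneg fun j _ => he j
  | succ s ih =>
    set m := lo + 2 ^ s with hm
    have h2s : 0 < 2 ^ s := by positivity
    have hmem : m ∈ Finset.Ioo lo (lo + 2 ^ (s + 1)) := by
      rw [Finset.mem_Ioo, pow_succ]; omega
    rw [← Finset.add_sum_erase _ _ hmem, search, ← hm]
    refine pr_bind_le _ (pr_test_le hO hx hb hu hWb m) (Finset.sum_nonneg fun j _ => he j) ?_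
    intro c hc
    have hsub : ∀ l, (l = lo ∨ l = m) → ∑ j ∈ Finset.Ioo l (l + 2 ^ s),
        (1 / 4) ^ u * testErr (level μ x j) ≤ ∑ j ∈ (Finset.Ioo lo (lo + 2 ^ (s + 1))).erase m,
        (1 / 4) ^ u * testErr (level μ x j) := by
      intro l hl
      refine Finset.sum_le_sum_of_subset_of_nonneg (fun j hj => ?_) fun j _ _ => he j
      rw [Finset.mem_Ioo] at hj
      rw [Finset.mem_erase, Finset.mem_Ioo, pow_succ]
      omega
    cases c with
    | true =>
      simp only [if_true]
      refine (ih m ?_ ?_).trans (hsub m (Or.inr rfl))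
      · by_contra! h; exact hc (Or.inl ⟨rfl, h⟩)
      · have : m + 2 ^ s = lo + 2 ^ (s + 1) := by rw [pow_succ]; omega
        rwa [this]
    | false =>
      simp only [Bool.false_eq_true, if_false]
      refine (ih lo hlo ?_).trans (hsub lo (Or.inl rfl))
      by_contra! h
      exact hc (Or.inr ⟨rfl, (div_le_one (level_pos μ x _)).2 h⟩)

end Search

lemma sum_geom_trunc_le {c : ℝ} (hc : 0 < c) (n : ℕ) :
    ∑ j ∈ Finset.range n, (if c * (1 / 2) ^ j ≤ 1 then c * (1 / 2) ^ j else 0)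
      ≤ 2 * (1 - min 1 (c * (1 / 2) ^ n)) := by
  induction n with
  | zero => simp
  | succ n ih =>
    rw [Finset.sum_range_succ, pow_succ]
    have h1 : 0 < c * (1 / 2) ^ n := by positivity
    set a := c * (1 / 2) ^ n
    have h2 : c * ((1 / 2) ^ n * (1 / 2)) = a / 2 := by ring
    rw [h2]
    split_ifs with h
    · rw [min_eq_right h] at ih
      rw [min_eq_right (by linarith)]; linarith
    · have : min 1 (a / 2) ≤ min 1 a := min_le_min_left _ (by linarith)
      linarith

lemma sum_geom_trunc_le' {c : ℝ} (hc : 0 < c) (n : ℕ) :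
    ∑ j ∈ Finset.range n, (if c * 2 ^ j ≤ 1 then c * 2 ^ j else 0)
      ≤ 2 * min 1 (c * 2 ^ n / 2) := by
  induction n with
  | zero => simp; positivity
  | succ n ih =>
    rw [Finset.sum_range_succ, pow_succ]
    have h1 : 0 < c * 2 ^ n := by positivity
    set a := c * 2 ^ n
    have h2 : c * (2 ^ n * 2) / 2 = a := by ring
    rw [h2]
    split_ifs with h
    · rw [min_eq_right h]
      have := min_le_right 1 (a / 2)
      linarith
    · rw [min_eq_left (by linarith)]
      have := min_le_left 1 (a / 2)
      linarith

lemma sum_testErr_le (μ : PMF Ω) (x : Ω) (lo hi : ℕ) :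
    ∑ j ∈ Finset.Ioo lo hi, testErr (level μ x j) ≤ 4 := by
  have hU := zero_lt_one.trans_le (one_le_passTotal μ x)
  have h1 : ∑ j ∈ Finset.Ioo lo hi, testErr (level μ x j)
      ≤ ∑ j ∈ Finset.range hi, testErr (level μ x j) :=
    Finset.sum_le_sum_of_subset_of_nonneg (fun j hj => by simp at hj ⊢; omega)
      fun j _ _ => testErr_nonneg (level_pos μ x j)
  refine h1.trans ?_
  simp only [testErr, Finset.sum_add_distrib]
  have h2 := sum_geom_trunc_le (by positivity : 0 < 32 * passTotal μ x) hi
  have h3 := sum_geom_trunc_le' (by positivity : 0 < 32 / passTotal μ x) hi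
  have h4 : ∀ j, 32 * passTotal μ x * (1 / 2) ^ j = 32 * level μ x j := fun j => by
    unfold level; ring
  have h5 : ∀ j : ℕ, 32 / passTotal μ x * 2 ^ j = 32 / level μ x j := fun j => by
    unfold level; rw [one_div, inv_pow]; field_simp
  simp only [h4, h5] at h2 h3
  have h6 : 0 < min 1 (32 * level μ x hi) :=
    lt_min one_pos (mul_pos (by norm_num) (level_pos μ x hi))
  have h7 := min_le_left 1 (32 / level μ x hi / 2)
  linarith

/-! ### Estimating the mass of one element -/

/-- Does `x` win the comparison with a sample of `μ`? -/
def passSample (x : Ω) : FinAlg Ω Bool :=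
  query Set.univ fun z => z.elim (ret false) fun y => compare x y

omit [Fintype Ω] in
lemma usesAtMost_passSample (x : Ω) : (passSample x).UsesAtMost 2 := by
  intro z
  cases z
  · trivial
  · exact usesAtMost_compare _ _

lemma mass_mul_passTotal (μ : PMF Ω) (x : Ω) : mass μ x * passTotal μ x
    = ∑ y, if y = x then mass μ x else mass μ x * mass μ y / (mass μ x + mass μ y) := by
  have h1 : passTotal μ x = ∑ y, ((if y = x then 1 else 0) + passRatio μ x y) := by
    rw [Finset.sum_add_distrib, passTotal]; simp
  rw [h1, Finset.mul_sum]
  refine Finset.sum_congr rfl fun y _ => ?_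
  unfold passRatio
  split_ifs
  · ring
  · ring

lemma ev_passSample (hO : IsCondOracle μ O) {x : Ω} (hx : 0 < mass μ x) :
    (passSample x).ev O (fun c => if c then (1 : ℝ) else 0) = mass μ x * passTotal μ x := by
  rw [passSample, ev_query_univ hO, mass_mul_passTotal]
  refine Finset.sum_congr rfl fun y _ => ?_
  simp only [Option.elim]
  by_cases hy : y = x
  · subst hy
    rw [ev_compare_self hO hx]; simp
  · rw [ev_compare hO hx hy]
    simp only [if_true, Bool.false_eq_true, if_false, hy]
    ring

lemma mass_mul_passTotal_le_one (hO : IsCondOracle μ O) {x : Ω} (hx : 0 < mass μ x) :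
    mass μ x * passTotal μ x ≤ 1 := by
  rw [← ev_passSample hO hx]
  refine (ev_mono _ fun c => ?_).trans (ev_const (O := O) (passSample x) 1).le
  split_ifs <;> norm_num

/-- The positive numbers `a` and `b` agree up to a factor of `c`. -/
def Near (c a b : ℝ) : Prop := a ≤ c * b ∧ b ≤ c * a

lemma Near.symm {c a b : ℝ} (h : Near c a b) : Near c b a := ⟨h.2, h.1⟩

lemma Near.trans {c d a b e : ℝ} (hc : 0 ≤ c) (hd : 0 ≤ d) (h : Near c a b) (h' : Near d b e) :
    Near (c * d) a e := by
  refine ⟨h.1.trans ?_, h'.2.trans ?_⟩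
  · rw [mul_assoc]; exact mul_le_mul_of_nonneg_left h'.1 hc
  · rw [mul_comm c d, mul_assoc]; exact mul_le_mul_of_nonneg_left h.2 hd

/-- A quotient of two estimates with relative error `η`. -/
lemma near_div {η w u W U : ℝ} (hη0 : 0 < η) (hη : η ≤ 1 / 100) (hW : 0 < W) (hU : 0 < U)
    (hw : |w - W| ≤ η * W) (hu : |u - U| ≤ η * U) : Near (1 + 4 * η) (w / u) (W / U) := by
  rw [abs_le] at hw hu
  have hu0 : 0 < u := by nlinarith
  have h1 : 1 + η ≤ (1 + 4 * η) * (1 - η) := by nlinarith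
  have h2 := mul_le_mul_of_nonneg_right h1 (mul_pos hW hU).le
  constructor
  · rw [mul_div_assoc', div_le_div_iff₀ hu0 hU]
    have h3 : (1 + 4 * η) * W * ((1 - η) * U) ≤ (1 + 4 * η) * W * u :=
      mul_le_mul_of_nonneg_left (by linarith) (by positivity)
    have h4 : w * U ≤ (1 + η) * W * U := mul_le_mul_of_nonneg_right (by linarith) hU.le
    linarith
  · rw [mul_div_assoc', div_le_div_iff₀ hU hu0]
    have h3 : (1 + 4 * η) * U * ((1 - η) * W) ≤ (1 + 4 * η) * U * w :=
      mul_le_mul_of_nonneg_left (by linarith) (by positivity)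
    have h4 : W * u ≤ W * ((1 + η) * U) := mul_le_mul_of_nonneg_left (by linarith) hW.le
    linarith

/-- The parameters of the mass estimator. -/
structure Params where
  /-- The number of samples in one game. -/
  gameLength : ℕ
  /-- Half the number of votes in a majority. -/
  votes : ℕ
  /-- The number of steps of the binary search. -/
  steps : ℕ
  /-- The number of games in an estimate. -/
  games : ℕ
  /-- The number of samples of `μ` in an estimate. -/
  samples : ℕ
  /-- The largest index of a grid point. -/
  maxIndex : ℕ
  /-- The grid consists of the powers of `ratio⁻¹`. -/
  ratio : ℝ

/-- Parameters that are large enough for accuracy `η` on a domain of `N` elements. -/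
structure Params.Adequate (p : Params) (η : ℝ) (N : ℕ) : Prop where
  pos : 0 < η
  small : η ≤ 1 / 100
  ratio_eq : p.ratio = 1 + 4 * η
  gameLength_ge : 132 ≤ η ^ 2 * p.gameLength
  games_ge : 2 * 10 ^ 9 ≤ η ^ 2 * p.games
  samples_ge : 128 ≤ η ^ 3 * p.samples
  votes_ge : 5 * (1 / 4) ^ p.votes ≤ η
  steps_ge : N / η ≤ 2 ^ 2 ^ p.steps
  maxIndex_ge : N / η ≤ p.ratio ^ p.maxIndex

variable (p : Params)

/-- One estimate of the mass of `x`, from games at density `2⁻ʲ`: the average score of these games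
gives the pass probability in units of the mass of `x`, and samples of `μ` give it absolutely. -/
noncomputable def estimateOnce (x : Ω) (j : ℕ) : FinAlg Ω ℝ :=
  ((passSample x).rep p.samples).bind fun l => ((trial x j p.gameLength).rep p.games).bind fun l' =>
    ret ((l.map fun c => if c then (1 : ℝ) else 0).sum / p.samples
      / (1 + (l'.map fun g : ℕ => (g : ℝ)).sum / p.games / (1 / 2) ^ j))

open Classical in
/-- The index of a grid point that is near to the majority of a list of estimates, or `0` if there
is none. -/
noncomputable def gridIndex (l : List ℝ) : Fin (p.maxIndex + 1) :=
  if h : ∃ i : Fin (p.maxIndex + 1),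
    p.votes < l.countP fun e => decide (Near (p.ratio ^ 2) e (p.ratio⁻¹ ^ (i : ℕ)))
  then h.choose else 0

/-- An estimate of the mass of `x`, as the index of a grid point. -/
noncomputable def estimate (x : Ω) : FinAlg Ω (Fin (p.maxIndex + 1)) :=
  (search x p.gameLength p.votes p.steps 0).bind fun j =>
    ((estimateOnce p x j).rep (2 * p.votes)).bind fun l => ret (gridIndex p l)

/-- An estimate of the mass of a sample of `μ`, as the index of a grid point. -/
noncomputable def sampleIndex (Ω : Type) [Fintype Ω] [DecidableEq Ω] (p : Params) :
    FinAlg Ω (Fin (p.maxIndex + 1)) :=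
  query Set.univ fun z => z.elim (ret 0) fun x => estimate p x

/-- A bound for the number of samples in a call of `sampleIndex`. -/
def Params.cost : ℕ :=
  p.steps * (2 * p.votes * (2 * p.gameLength))
    + 2 * p.votes * (p.samples * 2 + p.games * (2 * p.gameLength)) + 1

lemma usesAtMost_estimateOnce (x : Ω) (j : ℕ) : (estimateOnce p x j).UsesAtMost
    (p.samples * 2 + p.games * (2 * p.gameLength)) :=
  ((usesAtMost_passSample x).rep _).bind fun _ =>
    ((usesAtMost_trial x j _).rep _).bind (q' := 0) fun _ => trivial

lemma usesAtMost_sampleIndex : (sampleIndex Ω p).UsesAtMost p.cost := by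
  intro z
  cases z with
  | none => trivial
  | some x =>
    exact (usesAtMost_search x _ _ _ _).bind fun j =>
      ((usesAtMost_estimateOnce p x j).rep _).bind (q' := 0) fun _ => trivial

section Estimate

variable {p} {η : ℝ} {N : ℕ} (hp : p.Adequate η N) (hO : IsCondOracle μ O) {x : Ω}
  (hx : 0 < mass μ x) (hW : η ≤ mass μ x * passTotal μ x)
include hp

lemma Params.Adequate.gameLength_pos : 0 < p.gameLength := by
  rcases Nat.eq_zero_or_pos p.gameLength with h | h
  · have := hp.gameLength_ge; rw [h] at this; norm_num at this
  · exact h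

lemma Params.Adequate.games_pos : 0 < p.games := by
  rcases Nat.eq_zero_or_pos p.games with h | h
  · have := hp.games_ge; rw [h] at this; norm_num at this
  · exact h

lemma Params.Adequate.samples_pos : 0 < p.samples := by
  rcases Nat.eq_zero_or_pos p.samples with h | h
  · have := hp.samples_ge; rw [h] at this; norm_num at this
  · exact h

lemma Params.Adequate.votes_pos : 0 < p.votes := by
  rcases Nat.eq_zero_or_pos p.votes with h | h
  · have := hp.votes_ge; have := hp.small; rw [h] at *; norm_num at *; linarith
  · exact h

lemma Params.Adequate.one_lt_ratio : 1 < p.ratio := by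
  rw [hp.ratio_eq]; linarith [hp.pos]

include hO hx hW

/-- Chebyshev's inequality for both averages in an estimate, at a level of order `1`. -/
lemma pr_estimateOnce_le {j : ℕ} (hj : 1 < 32 * level μ x j) (hj' : level μ x j < 64) :
    (estimateOnce p x j).pr O (fun e => ¬ Near p.ratio e (mass μ x)) ≤ 1 / 16 := by
  have hη := hp.pos
  have hη1 := hp.small
  have hU := zero_lt_one.trans_le (one_le_passTotal μ x)
  set W := mass μ x * passTotal μ x with hWdef
  have hW0 : 0 < W := by positivity
  have hS := hp.samples_pos
  have hS' : (0 : ℝ) < p.samples := by exact_mod_cast hS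
  have hG := hp.games_pos
  have hG' : (0 : ℝ) < p.games := by exact_mod_cast hG
  have hb := hp.gameLength_pos
  have hb' : (0 : ℝ) < p.gameLength := by exact_mod_cast hb
  have hlev := level_pos μ x j
  have hd : (0 : ℝ) < (1 / 2) ^ j := by positivity
  have e1 : ((passSample x).ev O fun c => (if c then (1 : ℝ) else 0) ^ 2) ≤ W := by
    rw [hWdef, ← ev_passSample hO hx]
    exact ev_mono _ fun c => by split_ifs <;> norm_num
  have h1 := pr_rep_avg_le (passSample x) (fun c => if c then (1 : ℝ) else 0) (m := W)
    (δ := η * W / 2) (by positivity) e1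
    (by rw [ev_passSample hO hx, sub_self, abs_zero]; positivity) hS
  have h2 : W / (p.samples * (η * W / 2) ^ 2) ≤ 1 / 32 := by
    rw [div_le_div_iff₀ (by positivity) (by norm_num)]
    have h3 : η ^ 3 * p.samples * W ≤ η ^ 2 * p.samples * W ^ 2 := by
      have : η ^ 2 * p.samples * W * η ≤ η ^ 2 * p.samples * W * W :=
        mul_le_mul_of_nonneg_left hW (by positivity)
      nlinarith
    have h4 := mul_le_mul_of_nonneg_right hp.samples_ge hW0.le
    nlinarith
  -- The bound for the second moment at level `64`.
  have e2 : ((trial x j p.gameLength).ev O fun g => (g : ℝ) ^ 2) ≤ 8513 := by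
    refine (ev_trial_sq_le hO hx j).trans ?_
    nlinarith
  have e3 : |(trial x j p.gameLength).ev O (fun g => (g : ℝ)) - (level μ x j - (1 / 2) ^ j)|
      ≤ η * level μ x j / 2 := by
    refine (abs_ev_trial_sub_le hO hx j hb).trans ?_
    rw [← hWdef, div_div, div_le_div_iff₀ (by positivity) (by norm_num)]
    have h3 : 132 ≤ η * (W * p.gameLength) := by
      have : η * p.gameLength * η ≤ η * p.gameLength * W :=
        mul_le_mul_of_nonneg_left hW (by positivity)
      nlinarith [hp.gameLength_ge]
    have h4 := mul_le_mul_of_nonneg_right h3 hlev.le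
    nlinarith
  have h5 := pr_rep_avg_le (trial x j p.gameLength) (fun g => (g : ℝ))
    (δ := η * level μ x j / 2) (by positivity) e2 e3 hG
  have h6 : 8513 / (p.games * (η * level μ x j / 2) ^ 2) ≤ 1 / 32 := by
    rw [div_le_div_iff₀ (by positivity) (by norm_num)]
    have h7 : 1 ≤ 1024 * level μ x j ^ 2 := by nlinarith
    have h8 := mul_le_mul hp.games_ge h7 (by norm_num) (by positivity)
    nlinarith
  rw [estimateOnce]
  have key : ∀ l : List Bool,
      ¬ (2 * (η * W / 2) < |(l.map fun c => if c then (1 : ℝ) else 0).sum / p.samples - W|) →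
      (((trial x j p.gameLength).rep p.games).bind fun l' =>
        ret ((l.map fun c => if c then (1 : ℝ) else 0).sum / p.samples
        / (1 + (l'.map fun g : ℕ => (g : ℝ)).sum / p.games / (1 / 2) ^ j))).pr O
        (fun e => ¬ Near p.ratio e (mass μ x)) ≤ 1 / 32 := by
    intro l hl
    rw [pr_bind_ret]
    refine (pr_mono _ fun l' hl' => ?_).trans (h5.trans h6)
    by_contra! hcon
    rw [not_lt] at hl
    refine hl' ?_
    have hm : mass μ x = W / passTotal μ x := by rw [hWdef]; field_simp
    rw [hp.ratio_eq, hm]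
    refine near_div hη hη1 hW0 hU (by linarith) ?_
    have h9 : 1 + (l'.map fun g : ℕ => (g : ℝ)).sum / p.games / (1 / 2) ^ j - passTotal μ x
        = ((l'.map fun g : ℕ => (g : ℝ)).sum / p.games - (level μ x j - (1 / 2) ^ j))
          / (1 / 2) ^ j := by
      unfold level; field_simp; ring
    rw [h9, abs_div, abs_of_pos hd, div_le_iff₀ hd]
    have h10 : η * passTotal μ x * (1 / 2) ^ j = 2 * (η * level μ x j / 2) := by
      unfold level; ring
    rw [h10]
    exact hcon
  have := pr_bind_le (O := O) _ (h1.trans h2) (by norm_num) key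
  linarith

omit hO hx hW in
/-- If most estimates are near to `a`, then so is the chosen grid point. -/
lemma near_gridIndex {l : List ℝ} {a : ℝ} (hl : l.length = 2 * p.votes)
    (hcount : p.votes < l.countP fun e => open Classical in decide (Near p.ratio e a))
    (hi : ∃ i : Fin (p.maxIndex + 1), Near p.ratio a (p.ratio⁻¹ ^ (i : ℕ))) :
    Near (p.ratio ^ 3) a (p.ratio⁻¹ ^ (gridIndex p l : ℕ)) := by
  classical
  have hr := zero_lt_one.trans hp.one_lt_ratio
  have h : ∃ i : Fin (p.maxIndex + 1),
      p.votes < l.countP fun e => decide (Near (p.ratio ^ 2) e (p.ratio⁻¹ ^ (i : ℕ))) := by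
    obtain ⟨i, hi⟩ := hi
    refine ⟨i, hcount.trans_le (List.countP_mono_left fun e _ he => ?_)⟩
    have := (of_decide_eq_true he).trans hr.le hr.le hi
    rw [← sq] at this
    exact decide_eq_true this
  have hg : gridIndex p l = h.choose := by unfold gridIndex; rw [dif_pos h]
  have hspec := h.choose_spec
  rw [hg]
  set i := h.choose
  -- Two majorities of the same list have a common member.
  obtain ⟨e, h1, h2⟩ : ∃ e, Near p.ratio e a ∧ Near (p.ratio ^ 2) e (p.ratio⁻¹ ^ (i : ℕ)) := by
    by_contra! hcon
    have h3 := List.length_eq_countP_add_countP (fun e => decide (Near p.ratio e a)) (l := l)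
    have h4 : l.countP (fun e => decide (Near (p.ratio ^ 2) e (p.ratio⁻¹ ^ (i : ℕ))))
        ≤ l.countP (fun e => decide ¬(decide (Near p.ratio e a) = true)) :=
      List.countP_mono_left fun e _ he => by
        have := of_decide_eq_true he
        simp only [decide_eq_true_eq]
        exact fun h5 => hcon e h5 this
    have h5 : l.countP (fun e => decide (Near p.ratio e a))
        = l.countP fun e => open Classical in decide (Near p.ratio e a) := by congr!
    omega
  have := h1.symm.trans hr.le (by positivity) h2
  convert this using 1
  ring

lemma pr_estimate_le (hN : η / N ≤ mass μ x) (hN0 : 0 < N) :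
    (estimate p x).pr O
      (fun i => ¬ Near (p.ratio ^ 3) (mass μ x) (p.ratio⁻¹ ^ (i : ℕ))) ≤ η := by
  have hη := hp.pos
  have hη1 := hp.small
  have hr := hp.one_lt_ratio
  have hU := zero_lt_one.trans_le (one_le_passTotal μ x)
  have hN' : (0 : ℝ) < N := by exact_mod_cast hN0
  have hb' : (0 : ℝ) < p.gameLength := by exact_mod_cast hp.gameLength_pos
  have hW1 := mass_mul_passTotal_le_one hO hx
  have hinv : 1 / mass μ x ≤ N / η := by
    rw [div_le_div_iff₀ hx hη, one_mul]
    rw [div_le_iff₀ hN'] at hN; linarith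
  have hWb : 1 ≤ mass μ x * passTotal μ x * p.gameLength := by
    have h1 : η * p.gameLength ≤ mass μ x * passTotal μ x * p.gameLength :=
      mul_le_mul_of_nonneg_right hW hb'.le
    have h2 : η ^ 2 * p.gameLength ≤ η * p.gameLength := by
      rw [sq, mul_assoc]; exact mul_le_of_le_one_left (by positivity) (by linarith)
    linarith [hp.gameLength_ge]
  have h1 := pr_search_le hO hx hp.gameLength_pos hp.votes_pos hWb p.steps 0
    (by
      have := one_le_passTotal μ x
      unfold level; simp; linarith)
    (by
      have h2 : passTotal μ x ≤ 1 / mass μ x := by rw [le_div_iff₀ hx]; linarith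
      have h3 := h2.trans (hinv.trans hp.steps_ge)
      unfold level
      rw [zero_add, one_div, inv_pow, ← div_eq_inv_mul, div_lt_iff₀ (by positivity)]
      have : (0 : ℝ) < 2 ^ 2 ^ p.steps := by positivity
      linarith)
  rw [← Finset.mul_sum] at h1
  have h2 := h1.trans (mul_le_mul_of_nonneg_left (sum_testErr_le μ x _ _) (by positivity))
  have hgrid : ∃ i : Fin (p.maxIndex + 1), Near p.ratio (mass μ x) (p.ratio⁻¹ ^ (i : ℕ)) := by
    have hm1 : mass μ x ≤ 1 := by
      rw [← sum_mass μ]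
      exact Finset.single_le_sum (fun y _ => mass_nonneg μ y) (Finset.mem_univ x)
    obtain ⟨n, hn1, hn2⟩ := exists_nat_pow_near ((one_le_div hx).2 hm1) hr
    have hn : n ≤ p.maxIndex :=
      (pow_le_pow_iff_right₀ hr).1 (hn1.trans (hinv.trans hp.maxIndex_ge))
    have hpow : 0 < p.ratio ^ n := pow_pos (zero_lt_one.trans hr) n
    refine ⟨⟨n, by omega⟩, ?_, ?_⟩
    · simp only [inv_pow]
      rw [le_div_iff₀ hx] at hn1
      rw [← div_eq_mul_inv, le_div_iff₀ hpow]
      linarith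
    · simp only [inv_pow]
      rw [div_lt_iff₀ hx, pow_succ] at hn2
      rw [inv_le_iff_one_le_mul₀ hpow]
      nlinarith
  have key : ∀ j, ¬ ¬ (1 < 32 * level μ x j ∧ level μ x j < 64) →
      (((estimateOnce p x j).rep (2 * p.votes)).bind fun l => ret (gridIndex p l)).pr O
        (fun i => ¬ Near (p.ratio ^ 3) (mass μ x) (p.ratio⁻¹ ^ (i : ℕ)))
        ≤ (1 / 4) ^ p.votes := by
    classical
    intro j hj
    rw [not_not] at hj
    rw [pr_bind_ret]
    have hlen := pr_length_rep (O := O) (estimateOnce p x j) (2 * p.votes)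
    refine ((pr_mono _ fun l hl => ?_).trans (pr_or_le _ (fun l => l.length ≠ 2 * p.votes) _)).trans
      (add_le_add hlen.le (pr_rep_countP_le _ _ (pr_estimateOnce_le hp hO hx hW hj.1 hj.2)
        (2 * p.votes) p.votes)) |>.trans ?_
    · by_cases hl' : l.length = 2 * p.votes
      · right
        by_contra! hcon
        refine hl (near_gridIndex hp hl' ?_ hgrid)
        exact countP_lt_of_le_countP_not _ _ (fun e he => by simpa using he) hl' hcon
      · exact Or.inl hl'
    · rw [zero_add, pow_mul, ← mul_pow]
      exact le_of_eq (by norm_num)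
  refine (pr_bind_le (O := O) _ h2 (by positivity) key).trans ?_
  linarith [hp.votes_ge]

end Estimate

end FinAlg

namespace FinAlg

variable {Ω R : Type} [Fintype Ω] [DecidableEq Ω] {μ : PMF Ω} {O : Set Ω → PMF (Option Ω)}

/-! ### The law of the estimated grid index -/

omit [DecidableEq Ω] in
open Classical in
/-- Samples of `μ` rarely land on elements that are no heavier than a set of small probability. -/
lemma sum_mass_of_tail_lt (μ : PMF Ω) {t : ℝ} (ht : 0 ≤ t) :
    ∑ x, (if ∑ y, (if mass μ y ≤ mass μ x then mass μ y else 0) < t then mass μ x else 0) ≤ t := by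
  set A : Finset Ω := Finset.univ.filter fun x =>
    ∑ y, (if mass μ y ≤ mass μ x then mass μ y else 0) < t with hA
  rw [← Finset.sum_filter, ← hA]
  rcases A.eq_empty_or_nonempty with h | h
  · rw [h]; simpa using ht
  · obtain ⟨z, hz, hmax⟩ := A.exists_max_image (mass μ) h
    have hz' := (Finset.mem_filter.1 hz).2
    rw [← Finset.sum_filter] at hz'
    refine le_trans (Finset.sum_le_sum_of_subset_of_nonneg (fun x hx => ?_)
      fun y _ _ => mass_nonneg μ y) hz'.le
    exact Finset.mem_filter.2 ⟨Finset.mem_univ x, hmax x hx⟩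

open Classical in
/-- A sample of `μ` that is no heavier than `x` passes the comparison with probability at least
`1 / 2`. -/
lemma tail_le_mass_mul_passTotal (μ : PMF Ω) (x : Ω) :
    ∑ y, (if mass μ y ≤ mass μ x then mass μ y else 0) ≤ 2 * (mass μ x * passTotal μ x) := by
  rw [mass_mul_passTotal, Finset.mul_sum]
  refine Finset.sum_le_sum fun y _ => ?_
  have hx := mass_nonneg μ x
  have hy := mass_nonneg μ y
  by_cases hyx : y = x
  · subst hyx; simp; linarith
  · rw [if_neg hyx]
    split_ifs with h
    · rcases eq_or_lt_of_le hx with h0 | h0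
      · rw [← h0] at h ⊢; simp; linarith
      · rw [mul_div_assoc', le_div_iff₀ (by linarith)]
        nlinarith
    · positivity

open Classical in
lemma pr_not_eq_sum {ι : Type} [Fintype ι] (a : FinAlg Ω ι) (G : ι → Prop) :
    a.pr O (fun i => ¬ G i) = ∑ i, if G i then 0 else a.pr O fun i' => i' = i := by
  have h1 : ∀ i, (if G i then 0 else a.pr O fun i' => i' = i)
      = a.ev O fun i' => (if G i then 0 else 1) * if i' = i then 1 else 0 := by
    intro i
    rw [ev_const_mul]
    split_ifs
    · simp
    · rw [one_mul]; rfl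
  rw [Finset.sum_congr rfl fun i _ => h1 i, ← ev_sum]
  unfold pr
  congr 1
  ext i'
  simp

lemma sum_pr_eq_one {ι : Type} [Fintype ι] (a : FinAlg Ω ι) :
    ∑ i, a.pr O (fun i' => i' = i) = 1 := by
  classical
  have h1 := pr_not_eq_sum (O := O) a fun _ => False
  simp only [not_false_eq_true, if_false] at h1
  rw [← h1]
  simp [pr, ev_const]

variable {p : Params} {η : ℝ}

lemma pr_sampleIndex (hO : IsCondOracle μ O) (P : Fin (p.maxIndex + 1) → Prop) :
    (sampleIndex Ω p).pr O P = ∑ x, mass μ x * (estimate p x).pr O P :=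
  ev_query_univ hO _ _

open Classical in
/-- The estimated grid index of a sample of `μ` is rarely wrong: the exceptions come from errors of
the estimator, from elements of small mass, and from elements that rarely win comparisons. -/
lemma sum_bad_le (hp : p.Adequate η (Fintype.card Ω)) (hO : IsCondOracle μ O) :
    ∑ x, ∑ i : Fin (p.maxIndex + 1), (if Near (p.ratio ^ 3) (mass μ x) (p.ratio⁻¹ ^ (i : ℕ)) then 0
      else mass μ x * (estimate p x).pr O fun i' => i' = i) ≤ 4 * η := by
  have hη := hp.pos
  set N := Fintype.card Ω with hN
  have h1 : ∀ x, ∑ i : Fin (p.maxIndex + 1),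
      (if Near (p.ratio ^ 3) (mass μ x) (p.ratio⁻¹ ^ (i : ℕ)) then 0
      else mass μ x * (estimate p x).pr O fun i' => i' = i)
      ≤ η * mass μ x + ((if ∑ y, (if mass μ y ≤ mass μ x then mass μ y else 0) < 2 * η
        then mass μ x else 0) + η / N) := by
    intro x
    have hN0 : 0 < N := Fintype.card_pos_iff.2 ⟨x⟩
    have hN' : (0 : ℝ) < N := by exact_mod_cast hN0
    have hx0 := mass_nonneg μ x
    have h2 : ∑ i : Fin (p.maxIndex + 1),
        (if Near (p.ratio ^ 3) (mass μ x) (p.ratio⁻¹ ^ (i : ℕ)) then 0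
        else mass μ x * (estimate p x).pr O fun i' => i' = i)
        = mass μ x * (estimate p x).pr O
          (fun i => ¬ Near (p.ratio ^ 3) (mass μ x) (p.ratio⁻¹ ^ (i : ℕ))) := by
      rw [pr_not_eq_sum, Finset.mul_sum]
      exact Finset.sum_congr rfl fun i _ => by split_ifs <;> simp
    rw [h2]
    have h3 := mul_le_of_le_one_right hx0 (pr_le_one (O := O) (estimate p x)
      (fun i => ¬ Near (p.ratio ^ 3) (mass μ x) (p.ratio⁻¹ ^ (i : ℕ))))
    have h4 : 0 ≤ η / N := by positivity
    have h5 : 0 ≤ η * mass μ x := by positivity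
    split_ifs with h
    · linarith
    · by_cases hxN : η / N ≤ mass μ x
      · have hx : 0 < mass μ x := lt_of_lt_of_le (by positivity) hxN
        have hW : η ≤ mass μ x * passTotal μ x := by
          have := tail_le_mass_mul_passTotal μ x
          linarith
        have := mul_le_mul_of_nonneg_left (pr_estimate_le hp hO hx hW hxN hN0) hx0
        linarith
      · linarith
  refine (Finset.sum_le_sum fun x _ => h1 x).trans ?_
  rw [Finset.sum_add_distrib, Finset.sum_add_distrib, ← Finset.mul_sum, sum_mass, Finset.sum_const,
    Finset.card_univ, ← hN, nsmul_eq_mul]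
  have h6 := sum_mass_of_tail_lt μ (t := 2 * η) (by positivity)
  have h7 : (N : ℝ) * (η / N) ≤ η := by
    rw [mul_div_assoc']
    exact div_le_of_le_mul₀ (by positivity) hη.le (by rw [mul_comm])
  linarith

/-- The law of the estimated grid index determines the distribution up to a permutation. The
distance `33 * η` consists of `24 * η` for the error of two estimates, each within a factor of
`(1 + 4 * η) ^ 3`, of `η` for the distance of the laws, and of `8 * η` for the exceptions. -/
lemma exists_perm_tvDist_le {ν : PMF Ω} {O' : Set Ω → PMF (Option Ω)}
    (hp : p.Adequate η (Fintype.card Ω)) (hO : IsCondOracle μ O) (hO' : IsCondOracle ν O')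
    (hdist : ∑ i, |(sampleIndex Ω p).pr O (fun i' => i' = i)
      - (sampleIndex Ω p).pr O' (fun i' => i' = i)| ≤ 2 * η) :
    ∃ π : Equiv.Perm Ω, tvDist μ (ν.map π) ≤ 33 * η := by
  classical
  have hη := hp.pos
  have hη1 := hp.small
  have hr := zero_lt_one.trans hp.one_lt_ratio
  simp only [pr_sampleIndex hO, pr_sampleIndex hO'] at hdist
  obtain ⟨σ, hσ⟩ := exists_perm_dist_le (sum_mass μ) (sum_mass ν)
    (J := fun x i => mass μ x * (estimate p x).pr O fun i' => i' = i)
    (J' := fun x i => mass ν x * (estimate p x).pr O' fun i' => i' = i)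
    (fun x i => mul_nonneg (mass_nonneg μ x) (pr_nonneg _ _))
    (fun x i => mul_nonneg (mass_nonneg ν x) (pr_nonneg _ _))
    (fun x => by rw [← Finset.mul_sum, sum_pr_eq_one, mul_one])
    (fun x => by rw [← Finset.mul_sum, sum_pr_eq_one, mul_one])
    (fun x i => Near (p.ratio ^ 3) (mass μ x) (p.ratio⁻¹ ^ (i : ℕ)))
    (fun x i => Near (p.ratio ^ 3) (mass ν x) (p.ratio⁻¹ ^ (i : ℕ)))
    (δ := 4 * η) (κ := 24 * η) (θ := η) (sum_bad_le hp hO) (sum_bad_le hp hO') hdist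
    (by linarith) (by linarith) (fun x y i h h' => by
      have h1 := h.trans (by positivity) (by positivity) h'.symm
      rw [hp.ratio_eq, ← pow_add] at h1
      norm_num only at h1
      have h2 := one_add_mul_le_pow (a := -(4 * η)) (by linarith) 6
      have h3 : ((1 + -(4 * η)) * (1 + 4 * η)) ^ 6 ≤ 1 :=
        pow_le_one₀ (by nlinarith) (by nlinarith)
      rw [mul_pow] at h3
      have h4 : (1 - 24 * η) * (1 + 4 * η) ^ 6 ≤ 1 := by
        refine le_trans (mul_le_mul_of_nonneg_right ?_ (by positivity)) h3
        push_cast at h2; linarith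
      have h5 : max (mass μ x) (mass ν y) ≤ (1 + 4 * η) ^ 6 * min (mass μ x) (mass ν y) := by
        rcases le_total (mass μ x) (mass ν y) with h6 | h6
        · rw [max_eq_right h6, min_eq_left h6]; exact h1.2
        · rw [max_eq_left h6, min_eq_right h6]; exact h1.1
      calc (1 - 24 * η) * max (mass μ x) (mass ν y)
          ≤ (1 - 24 * η) * ((1 + 4 * η) ^ 6 * min (mass μ x) (mass ν y)) :=
            mul_le_mul_of_nonneg_left h5 (by linarith)
        _ = ((1 - 24 * η) * (1 + 4 * η) ^ 6) * min (mass μ x) (mass ν y) := by ring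
        _ ≤ _ := mul_le_of_le_one_left (le_min (mass_nonneg _ _) (mass_nonneg _ _)) h4)
  refine ⟨σ.symm, ?_⟩
  have h1 : ∀ x, ((ν.map σ.symm) x).toReal = mass ν (σ x) := by
    intro x
    rw [PMF.map_apply, mass, tsum_eq_single (σ x)]
    · simp
    · intro y hy
      rw [if_neg]
      rintro rfl
      simp at hy
  unfold tvDist
  simp only [h1]
  refine le_trans hσ ?_
  linarith

/-! ### The verdicts -/

/-- The relative frequency of a value in a list. -/
noncomputable def freq {B : ℕ} (l : List (Fin B)) (i : Fin B) : ℝ :=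
  (l.map fun i' => if i' = i then (1 : ℝ) else 0).sum / l.length

/-- The empirical law of `m` independent outputs is probably near to the true law. -/
lemma pr_freq_le {B : ℕ} (a : FinAlg Ω (Fin B)) (hη : 0 < η) {m : ℕ} (hm : 0 < m)
    (hBm : 3 * B ≤ η ^ 2 * m) :
    (a.rep m).pr O (fun l => η < ∑ i, |freq l i - a.pr O fun i' => i' = i|) ≤ 1 / 3 := by
  have hm' : (0 : ℝ) < m := by exact_mod_cast hm
  have hev : ∀ i, (a.ev O fun i' => if i' = i then (1 : ℝ) else 0) = a.pr O fun i' => i' = i :=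
    fun i => by unfold pr; congr!
  set f : List (Fin B) → ℝ := fun l => ∑ i,
    ((l.map fun i' => if i' = i then (1 : ℝ) else 0).sum - m * a.pr O fun i' => i' = i) ^ 2 with hf
  have h1 : (a.rep m).ev O f ≤ m := by
    rw [hf, ev_sum]
    calc _ ≤ ∑ i, m * a.pr O (fun i' => i' = i) := Finset.sum_le_sum fun i _ => by
            have h2 := ev_rep_sq_le (O := O) a (fun i' => if i' = i then (1 : ℝ) else 0)
              (v := a.pr O fun i' => i' = i)
              (by rw [← hev]; exact ev_mono _ fun i' => by split_ifs <;> norm_num) m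
            rwa [hev] at h2
      _ = m := by rw [← Finset.mul_sum, sum_pr_eq_one, mul_one]
  rcases Nat.eq_zero_or_pos B with hB | hB
  · subst hB
    have h2 : (a.rep m).pr O (fun l => η < ∑ i, |freq l i - a.pr O fun i' => i' = i|)
        ≤ (a.rep m).pr O fun _ => False := pr_mono _ fun l hl => by simp at hl; linarith
    refine h2.trans ?_
    simp [pr, ev_const]
  · have hB' : (0 : ℝ) < B := by exact_mod_cast hB
    have hlen := pr_length_rep (O := O) a m
    refine ((pr_mono _ fun l hl => ?_).trans (pr_or_le _ (fun l => l.length ≠ m) _)).trans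
      (add_le_add hlen.le (pr_le_div _ (f := f) (fun l => Finset.sum_nonneg fun i _ => sq_nonneg _)
        (c := (η * m) ^ 2 / B) (P := fun l => (η * m) ^ 2 / B ≤ f l) (by positivity)
        fun l hl => hl)) |>.trans ?_
    · by_cases hl' : l.length = m
      · right
        rw [div_le_iff₀ hB']
        have h2 : ∀ i, |(l.map fun i' => if i' = i then (1 : ℝ) else 0).sum
            - m * a.pr O fun i' => i' = i| = m * |freq l i - a.pr O fun i' => i' = i| := by
          intro i
          rw [← abs_of_pos hm', ← abs_mul, abs_of_pos hm', freq, hl', mul_sub,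
            mul_div_cancel₀ _ hm'.ne']
        have h3 := sq_sum_le_card_mul_sum_sq (s := Finset.univ) (f := fun i =>
          |(l.map fun i' => if i' = i then (1 : ℝ) else 0).sum - m * a.pr O fun i' => i' = i|)
        simp only [sq_abs, Finset.card_univ, Fintype.card_fin] at h3
        simp only [h2, ← Finset.mul_sum] at h3
        have h4 : (η * m) ^ 2 ≤ (m * ∑ i, |freq l i - a.pr O fun i' => i' = i|) ^ 2 := by
          refine pow_le_pow_left₀ (by positivity) ?_ 2
          rw [mul_comm]
          exact mul_le_mul_of_nonneg_left hl.le hm'.le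
        rw [mul_comm (f l)]
        refine le_trans ?_ h3
        exact h4
      · exact Or.inl hl'
    · rw [zero_add]
      refine (div_le_div_of_nonneg_right h1 (by positivity)).trans ?_
      rw [div_div_eq_mul_div, div_le_div_iff₀ (by positivity) (by norm_num)]
      nlinarith [mul_le_mul_of_nonneg_left hBm hm'.le]

open Classical in
/-- Accept a property if it has a member for which the list is typical: the empirical law of the
list is near to the law of the estimated grid index under some oracle for that member. -/
noncomputable def verdict (p : Params) (η : ℝ) (l : List (Fin (p.maxIndex + 1)))
    (P : Set (PMF Ω)) : Bool :=
  decide (∃ ν ∈ P, ∃ O', IsCondOracle ν O' ∧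
    ∑ i, |freq l i - (sampleIndex Ω p).pr O' fun i' => i' = i| ≤ η)

/-- The tester: `m` independent grid indices, and the verdicts that they imply. -/
noncomputable def tester (Ω : Type) [Fintype Ω] [DecidableEq Ω] (p : Params) (η : ℝ) (m : ℕ) :
    FinAlg Ω (Set (PMF Ω) → Bool) :=
  ((sampleIndex Ω p).rep m).bind fun l => ret (verdict p η l)

lemma usesAtMost_tester (p : Params) (η : ℝ) (m : ℕ) :
    (tester Ω p η m).UsesAtMost (m * p.cost) :=
  ((usesAtMost_sampleIndex p).rep m).bind (q' := 0) fun _ => trivial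

lemma epsTests_tester {ε : ℝ} {m : ℕ} (hp : p.Adequate η (Fintype.card Ω)) (hε : 33 * η ≤ ε)
    (hm : 3 * (p.maxIndex + 1 : ℕ) ≤ η ^ 2 * m) {P : Set (PMF Ω)} (hP : LabelInvariant P) :
    EpsTests (tester Ω p η m).toCondAlg ε P := by
  classical
  intro μ O hO
  have hη := hp.pos
  have hm0 : 0 < m := by
    rcases Nat.eq_zero_or_pos m with h | h
    · rw [h] at hm; push_cast at hm
      have : (0 : ℝ) ≤ p.maxIndex := Nat.cast_nonneg _
      linarith
    · exact h
  have hgood : 2 / 3 ≤ ((sampleIndex Ω p).rep m).pr O (fun l =>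
      ¬ (η < ∑ i, |freq l i - (sampleIndex Ω p).pr O fun i' => i' = i|)) := by
    rw [pr_not]
    linarith [pr_freq_le (O := O) (sampleIndex Ω p) hη hm0 hm]
  have h23 : (2 / 3 : ENNReal) = ENNReal.ofReal (2 / 3) := by
    rw [ENNReal.ofReal_div_of_pos (by norm_num)]; simp
  constructor
  · intro hμ
    rw [map_run_toCondAlg, tester, pr_bind_ret, h23]
    refine ENNReal.ofReal_le_ofReal (hgood.trans (pr_mono _ fun l hl => ?_))
    exact decide_eq_true ⟨μ, hμ, O, hO, not_lt.1 hl⟩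
  · intro hfar
    rw [map_run_toCondAlg, tester, pr_bind_ret, h23]
    refine ENNReal.ofReal_le_ofReal (hgood.trans (pr_mono _ fun l hl => ?_))
    refine decide_eq_false ?_
    rintro ⟨ν, hν, O', hO', hl'⟩
    obtain ⟨π, hπ⟩ := exists_perm_tvDist_le hp hO hO' (by
      calc _ ≤ ∑ i, (|freq l i - (sampleIndex Ω p).pr O fun i' => i' = i|
            + |freq l i - (sampleIndex Ω p).pr O' fun i' => i' = i|) :=
            Finset.sum_le_sum fun i _ => by
              rw [abs_sub_comm (freq l i)]; exact abs_sub_le _ _ _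
        _ ≤ 2 * η := by rw [Finset.sum_add_distrib]; linarith [not_lt.1 hl])
    linarith [hfar _ (hP π ν hν)]

end FinAlg

lemma epsTests_of_subsingleton {Ω : Type} [Fintype Ω] [Subsingleton Ω] (ε : ℝ) (hε : 0 < ε)
    (P : Set (PMF Ω)) (v : Set (PMF Ω) → Bool) (hv : v P = true ↔ P.Nonempty) :
    EpsTests (CondAlg.ret v) ε P := by
  intro μ O _
  have h1 : (2 / 3 : ENNReal) ≤ 1 := by
    refine ENNReal.div_le_of_le_mul ?_
    rw [one_mul]; norm_num
  have hsub : ∀ ν : PMF Ω, tvDist μ ν = 0 := by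
    intro ν
    have h2 : ∀ (τ : PMF Ω) (x : Ω), (τ x).toReal = 1 := by
      intro τ x
      rw [← FinAlg.sum_toReal_pmf τ, Fintype.sum_subsingleton _ x]
    simp [tvDist, h2]
  simp only [CondAlg.run, PMF.pure_map]
  constructor
  · intro hμ
    rw [hv.2 ⟨μ, hμ⟩]; simpa using h1
  · intro hfar
    have : v P = false := by
      rw [← Bool.not_eq_true, hv]
      rintro ⟨ν, hν⟩
      have := hfar ν hν
      rw [hsub] at this
      linarith
    rw [this]; simpa using h1

/-! ### The choice of parameters -/

/-- The parameters for domain size `N` and accuracy `ε`. -/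
noncomputable def testerParams (N : ℕ) (ε : ℝ) : FinAlg.Params where
  gameLength := ⌈132 / (ε / 100) ^ 2⌉₊
  votes := ⌈Real.log (5 / (ε / 100))⌉₊
  steps := ⌈2 * Real.log (2 * Real.log (N / (ε / 100)))⌉₊
  games := ⌈2 * 10 ^ 9 / (ε / 100) ^ 2⌉₊
  samples := ⌈128 / (ε / 100) ^ 3⌉₊
  maxIndex := ⌈Real.log (N / (ε / 100)) / (2 * (ε / 100))⌉₊
  ratio := 1 + 4 * (ε / 100)

/-- The number of grid indices that the tester collects. -/
noncomputable def testerRounds (N : ℕ) (ε : ℝ) : ℕ :=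
  ⌈3 * ((testerParams N ε).maxIndex + 1 : ℕ) / (ε / 100) ^ 2⌉₊

lemma adequate_testerParams {N : ℕ} {ε : ℝ} (hN : 2 ≤ N) (hε0 : 0 < ε) (hε1 : ε < 1) :
    (testerParams N ε).Adequate (ε / 100) N := by
  have hη : 0 < ε / 100 := by positivity
  have hη1 : ε / 100 ≤ 1 / 100 := by linarith
  have hN' : (2 : ℝ) ≤ N := by exact_mod_cast hN
  set η := ε / 100 with hηdef
  have hX : 200 ≤ N / η := by rw [le_div_iff₀ hη]; linarith
  have hX0 : 0 < N / η := by linarith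
  have hlogX : 1 ≤ Real.log (N / η) := by
    rw [Real.le_log_iff_exp_le hX0]; linarith [Real.exp_one_lt_d9]
  have hlog2 := Real.log_two_gt_d9
  have hlt : ∀ n : ℕ, Real.exp (n / 2) ≤ 2 ^ n := by
    intro n
    rw [← Real.exp_log (by positivity : (0 : ℝ) < 2 ^ n), Real.log_pow]
    exact Real.exp_le_exp.2 (by nlinarith [(Nat.cast_nonneg n : (0 : ℝ) ≤ n)])
  refine ⟨hη, hη1, rfl, ?_, ?_, ?_, ?_, ?_, ?_⟩
  · rw [mul_comm (η ^ 2), ← div_le_iff₀ (by positivity)]; exact Nat.le_ceil _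
  · rw [mul_comm (η ^ 2), ← div_le_iff₀ (by positivity)]; exact Nat.le_ceil _
  · rw [mul_comm (η ^ 3), ← div_le_iff₀ (by positivity)]; exact Nat.le_ceil _
  · have h1 : Real.log (5 / η) ≤ (testerParams N ε).votes := Nat.le_ceil _
    set u := (testerParams N ε).votes
    have h2 : 5 / η ≤ 4 ^ u := by
      rw [← Real.exp_log (by positivity : 0 < 5 / η)]
      refine (Real.exp_le_exp.2 h1).trans ?_
      have h3 := hlt (2 * u)
      rw [pow_mul] at h3
      norm_num at h3
      refine le_trans (le_of_eq ?_) h3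
      ring_nf
    rw [div_le_iff₀ hη] at h2
    rw [one_div, inv_pow, ← div_eq_mul_inv, div_le_iff₀ (by positivity)]
    linarith
  · have h1 : 2 * Real.log (2 * Real.log (N / η)) ≤ (testerParams N ε).steps := Nat.le_ceil _
    set s := (testerParams N ε).steps
    have h2 : 2 * Real.log (N / η) ≤ (2 ^ s : ℕ) := by
      rw [← Real.exp_log (by linarith : 0 < 2 * Real.log (N / η))]
      push_cast
      exact (Real.exp_le_exp.2 (by linarith)).trans (hlt s)
    refine le_trans ?_ (hlt (2 ^ s))
    rw [← Real.log_le_iff_le_exp hX0]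
    linarith
  · have h1 : Real.log (N / η) / (2 * η) ≤ (testerParams N ε).maxIndex := Nat.le_ceil _
    set B := (testerParams N ε).maxIndex
    have hr : (0 : ℝ) < (testerParams N ε).ratio := by
      change 0 < 1 + 4 * η; linarith
    have h2 : 2 * η ≤ Real.log (testerParams N ε).ratio := by
      refine le_trans ?_ (Real.one_sub_inv_le_log_of_pos hr)
      change 2 * η ≤ 1 - (1 + 4 * η)⁻¹
      have h3 : 1 - (1 + 4 * η)⁻¹ = 4 * η / (1 + 4 * η) := by field_simp; ring
      rw [h3, le_div_iff₀ (by linarith)]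
      nlinarith
    rw [← Real.log_le_log_iff hX0 (by positivity), Real.log_pow]
    rw [div_le_iff₀ (by linarith)] at h1
    exact h1.trans (mul_le_mul_of_nonneg_left h2 (Nat.cast_nonneg _))

lemma cost_le (p : FinAlg.Params) {I L M : ℝ} (hI : 1 ≤ I) (hL : 1 ≤ L) (hM : 1 ≤ M)
    (hb : (p.gameLength : ℝ) ≤ 2 * 10 ^ 6 * I ^ 2) (hG : (p.games : ℝ) ≤ 3 * 10 ^ 13 * I ^ 2)
    (hS : (p.samples : ℝ) ≤ 2 * 10 ^ 8 * I ^ 3) (hu : (p.votes : ℝ) ≤ 8 * L)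
    (hs : (p.steps : ℝ) ≤ 13 * (M * L)) : (p.cost : ℝ) ≤ 10 ^ 22 * (M * L ^ 2 * I ^ 4) := by
  unfold FinAlg.Params.cost
  push_cast
  have h1 : p.steps * (2 * (p.votes : ℝ) * (2 * p.gameLength))
      ≤ 13 * (M * L) * (2 * (8 * L) * (2 * (2 * 10 ^ 6 * I ^ 2))) := by gcongr
  have h2 : 2 * (p.votes : ℝ) * (p.samples * 2 + p.games * (2 * p.gameLength))
      ≤ 2 * (8 * L) * (2 * 10 ^ 8 * I ^ 3 * 2
        + 3 * 10 ^ 13 * I ^ 2 * (2 * (2 * 10 ^ 6 * I ^ 2))) := by gcongr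
  have h24 : I ^ 2 ≤ I ^ 4 := pow_le_pow_right₀ hI (by norm_num)
  have h34 : I ^ 3 ≤ I ^ 4 := pow_le_pow_right₀ hI (by norm_num)
  have h14 : 1 ≤ I ^ 4 := one_le_pow₀ hI
  have hLL : L ≤ L ^ 2 := le_self_pow₀ hL (by norm_num)
  have hLM : L ≤ M * L ^ 2 := hLL.trans (le_mul_of_one_le_left (by positivity) hM)
  have h3 : M * L ^ 2 * I ^ 2 ≤ M * L ^ 2 * I ^ 4 := by gcongr
  have h4 : L * I ^ 3 ≤ M * L ^ 2 * I ^ 4 := by gcongr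
  have h5 : L * I ^ 4 ≤ M * L ^ 2 * I ^ 4 := by gcongr
  have h6 : 1 ≤ M * L ^ 2 * I ^ 4 := one_le_mul_of_one_le_of_one_le (hL.trans hLM) h14
  have h7 : 13 * (M * L) * (2 * (8 * L) * (2 * (2 * 10 ^ 6 * I ^ 2)))
      = 832 * 10 ^ 6 * (M * L ^ 2 * I ^ 2) := by ring
  have h8 : 2 * (8 * L) * (2 * 10 ^ 8 * I ^ 3 * 2
      + 3 * 10 ^ 13 * I ^ 2 * (2 * (2 * 10 ^ 6 * I ^ 2)))
      = 64 * 10 ^ 8 * (L * I ^ 3) + 192 * 10 ^ 19 * (L * I ^ 4) := by ring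
  linarith

lemma rounds_mul_cost_le {N : ℕ} {ε : ℝ} (hN : 2 ≤ N) (hε0 : 0 < ε) (hε1 : ε < 1) :
    ((testerRounds N ε * (testerParams N ε).cost : ℕ) : ℝ)
      ≤ 10 ^ 30 * (Real.log N * max 1 (Real.log (Real.log N)) / ε ^ 7)
        * (1 + Real.log (1 / ε)) ^ 3 := by
  have hN' : (2 : ℝ) ≤ N := by exact_mod_cast hN
  set ℓ := Real.log N with hℓ
  set M := max 1 (Real.log ℓ) with hM
  set L := 1 + Real.log (1 / ε) with hL
  set I := 1 / ε with hI
  have hI1 : 1 ≤ I := by rw [hI, le_div_iff₀ hε0]; linarith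
  have hL1 : 1 ≤ L := by have := Real.log_nonneg hI1; linarith
  have hM1 : 1 ≤ M := le_max_left _ _
  have hlog2 := Real.log_two_gt_d9
  have hℓ0 : 69 / 100 ≤ ℓ := by
    have := Real.log_le_log (by norm_num) hN'
    linarith
  have hceil : ∀ {a b : ℝ}, 0 ≤ a → a + 1 ≤ b → (⌈a⌉₊ : ℝ) ≤ b := fun ha hab =>
    (Nat.ceil_lt_add_one ha).le.trans hab
  have hI2 : 1 ≤ I ^ 2 := one_le_pow₀ hI1
  have hI3 : 1 ≤ I ^ 3 := one_le_pow₀ hI1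
  have hb : ((testerParams N ε).gameLength : ℝ) ≤ 2 * 10 ^ 6 * I ^ 2 := by
    refine hceil (by positivity) ?_
    have : 132 / (ε / 100) ^ 2 = 132 * 10 ^ 4 * I ^ 2 := by rw [hI]; field_simp; norm_num
    rw [this]; linarith
  have hG : ((testerParams N ε).games : ℝ) ≤ 3 * 10 ^ 13 * I ^ 2 := by
    refine hceil (by positivity) ?_
    have : 2 * 10 ^ 9 / (ε / 100) ^ 2 = 2 * 10 ^ 13 * I ^ 2 := by rw [hI]; field_simp; norm_num
    rw [this]; linarith
  have hS : ((testerParams N ε).samples : ℝ) ≤ 2 * 10 ^ 8 * I ^ 3 := by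
    refine hceil (by positivity) ?_
    have : 128 / (ε / 100) ^ 3 = 128 * 10 ^ 6 * I ^ 3 := by rw [hI]; field_simp; norm_num
    rw [this]; linarith
  have hexp := Real.exp_one_gt_d9
  have hexp_pow : ∀ n : ℕ, (27 / 10 : ℝ) ^ n ≤ Real.exp n := by
    intro n
    rw [← mul_one (n : ℝ), Real.exp_nat_mul]
    exact pow_le_pow_left₀ (by norm_num) (by linarith) n
  have hlog : ∀ (a : ℝ) (n : ℕ), 0 < a → a ≤ (27 / 10 : ℝ) ^ n → Real.log a ≤ n :=
    fun a n ha h => (Real.log_le_iff_le_exp ha).2 (h.trans (hexp_pow n))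
  have hu : ((testerParams N ε).votes : ℝ) ≤ 8 * L := by
    have h1 : (5 : ℝ) / (ε / 100) = 500 * I := by rw [hI]; field_simp; norm_num
    have h2 : Real.log (5 / (ε / 100)) = Real.log 500 + (L - 1) := by
      rw [h1, Real.log_mul (by norm_num) (by positivity)]; simp [hL]
    refine hceil (Real.log_nonneg ?_) ?_
    · rw [h1]; linarith
    · rw [h2]
      have := hlog 500 7 (by norm_num) (by norm_num)
      push_cast at this
      linarith
  have hX : Real.log (N / (ε / 100)) ≤ 11 * (ℓ * L) := by
    have h1 : (N : ℝ) / (ε / 100) = 100 * (N * I) := by rw [hI]; field_simp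
    rw [h1, Real.log_mul (by norm_num) (by positivity),
      Real.log_mul (by positivity) (by positivity)]
    have h2 := hlog 100 5 (by norm_num) (by norm_num)
    push_cast at h2
    have h3 : Real.log I = L - 1 := by rw [hL]; ring
    rw [h3, ← hℓ]
    nlinarith
  have hX1 : 1 ≤ Real.log (N / (ε / 100)) := by
    have h1 : 200 ≤ (N : ℝ) / (ε / 100) := by rw [le_div_iff₀ (by positivity)]; linarith
    rw [Real.le_log_iff_exp_le (by linarith)]; linarith [Real.exp_one_lt_d9]
  have hML : 1 ≤ M * L := by nlinarith
  have hs : ((testerParams N ε).steps : ℝ) ≤ 13 * (M * L) := by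
    have h1 : Real.log (2 * Real.log (N / (ε / 100))) ≤ 6 * (M * L) := by
      have h2 : Real.log (2 * Real.log (N / (ε / 100))) ≤ Real.log (22 * (ℓ * L)) :=
        Real.log_le_log (by linarith) (by linarith)
      have h6 : Real.log (22 * (ℓ * L)) = Real.log 22 + (Real.log ℓ + Real.log L) := by
        rw [Real.log_mul (by norm_num) (by positivity),
          Real.log_mul (by positivity) (by positivity)]
      have h3 := hlog 22 4 (by norm_num) (by norm_num)
      push_cast at h3
      have h4 : Real.log ℓ ≤ M := le_max_right _ _
      have h5 := Real.log_le_sub_one_of_pos (by linarith : 0 < L)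
      nlinarith
    refine hceil (mul_nonneg (by norm_num) (Real.log_nonneg (by linarith))) ?_
    linarith
  have hℓL : 69 / 100 ≤ ℓ * L := by nlinarith
  have hB : (((testerParams N ε).maxIndex + 1 : ℕ) : ℝ) ≤ 554 * (ℓ * L * I) := by
    have h1 : Real.log (N / (ε / 100)) / (2 * (ε / 100))
        = 50 * (Real.log (N / (ε / 100)) * I) := by
      rw [hI]; generalize Real.log (N / (ε / 100)) = y; field_simp; ring
    have h2 : ((testerParams N ε).maxIndex : ℝ) ≤ 552 * (ℓ * L * I) := by
      refine hceil (by positivity) ?_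
      rw [h1]
      have h3 := mul_le_mul_of_nonneg_right hX (by linarith : 0 ≤ I)
      nlinarith
    push_cast
    nlinarith
  have hm : (testerRounds N ε : ℝ) ≤ 2 * 10 ^ 7 * (ℓ * L * I ^ 3) := by
    refine hceil (by positivity) ?_
    have h1 : 3 * (((testerParams N ε).maxIndex + 1 : ℕ) : ℝ) / (ε / 100) ^ 2
        = 3 * 10 ^ 4 * (((testerParams N ε).maxIndex + 1 : ℕ) : ℝ) * I ^ 2 := by
      rw [hI]; field_simp; norm_num
    rw [h1]
    have h2 := mul_le_mul_of_nonneg_right hB (by positivity : 0 ≤ I ^ 2)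
    have h3 : ℓ * L * I * I ^ 2 = ℓ * L * I ^ 3 := by ring
    nlinarith
  have hcost := cost_le _ hI1 hL1 hM1 hb hG hS hu hs
  push_cast
  calc _ ≤ 2 * 10 ^ 7 * (ℓ * L * I ^ 3) * (10 ^ 22 * (M * L ^ 2 * I ^ 4)) :=
        mul_le_mul hm hcost (Nat.cast_nonneg _) (by positivity)
    _ = 2 * 10 ^ 29 * (ℓ * M * I ^ 7 * L ^ 3) := by ring
    _ ≤ 10 ^ 30 * (ℓ * M * I ^ 7 * L ^ 3) :=
        mul_le_mul_of_nonneg_right (by norm_num) (by positivity)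
    _ = _ := by rw [hI]; field_simp

theorem corollary8p2 :
    ∃ (C : ℝ) (k : ℕ) (T : (N : ℕ) → ℝ → CondAlg (Fin N) (Set (PMF (Fin N)) → Bool)),
      0 < C ∧ ∀ (N : ℕ) (ε : ℝ), 0 < ε → ε < 1 →
        (T N ε).UsesAtMost
          ⌊C * (Real.log N * max 1 (Real.log (Real.log N)) / ε ^ 7) *
            (1 + Real.log (1 / ε)) ^ k⌋₊ ∧
        ∀ P : Set (PMF (Fin N)), LabelInvariant P → EpsTests (T N ε) ε P := by
  classical
  refine ⟨10 ^ 30, 3, fun N ε => if 2 ≤ N then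
    (FinAlg.tester (Fin N) (testerParams N ε) (ε / 100) (testerRounds N ε)).toCondAlg
    else CondAlg.ret fun P => decide P.Nonempty, by norm_num, fun N ε hε0 hε1 => ?_⟩
  by_cases hN : 2 ≤ N
  · simp only [hN, if_true]
    refine ⟨((FinAlg.usesAtMost_tester _ _ _).mono
      (Nat.le_floor (rounds_mul_cost_le hN hε0 hε1))).toCondAlg, fun P hP => ?_⟩
    refine FinAlg.epsTests_tester (by simpa using adequate_testerParams hN hε0 hε1)
      (by linarith) ?_ hP
    rw [mul_comm ((ε / 100) ^ 2), ← div_le_iff₀ (by positivity)]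
    exact Nat.le_ceil _
  · simp only [hN, if_false]
    refine ⟨by simp [CondAlg.UsesAtMost], fun P _ => ?_⟩
    have : Subsingleton (Fin N) := Fin.subsingleton_iff_le_one.2 (by omega)
    exact epsTests_of_subsingleton ε hε0 P _ (by simp)
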